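/- **Theorem 5.3.** Let $d\ge 1$, $\varepsilon>0$, $A\in\mathbb R^{d\times d}$, $F\in C^3(\mathbb R^d,\mathbb R^d)$, $m_0\in\mathbb R^d$, and let $\Sigma_{\mathrm{pr}}\in\mathbb R^{d\times d}$ be symmetric positive definite. For $\tau\ge 0$ let $G_\tau(x)=Ax+\tau F(x)$, let $y_\tau\in\mathbb R^d$ be data, and let $\mu^{y_\tau}$ be the posterior distribution for the prior $\mu=\mathcal N(m_0,\Sigma_{\mathrm{pr}})$, i.e. the probability measure $$\mu^{y_\tau}(\mathrm dx)\propto\exp\Big(-\tfrac1{2\varepsilon}|y_\tau-G_\tau(x)|^2\Big)\,\mu(\mathrm dx).$$ For a positive definite matrix $S$ write $\|h\|_S=(h^{\mathsf T}S^{-1}h)^{1/2}$ and $\|D^jF(x)\|_S=\sup\{|D^jF(x)(h_1,\dots,h_j)| : \|h_1\|_S,\dots,\|h_j\|_S\le 1\}$, where $|\cdot|$ is the Euclidean norm (so $\|D^0F(x)\|_S=|F(x)|$); $\|\cdot\|$ without index is the Euclidean operator norm of a matrix. Assume that there is $\tau_0>0$ with the following properties. 1. For every $\tau\in[0,\tau_0]$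 the function $$I_\tau(x)=\tfrac12|Ax+\tau F(x)-y_\tau|^2+\tfrac\varepsilon2\|x-m_0\|_{\Sigma_{\mathrm{pr}}}^2+c_\tau$$ has a unique global minimizer $\hat x_\tau$ (the constant $c_\tau$ being chosen such that $I_\tau(\hat x_\tau)=0$), and $D^2I_\tau(\hat x_\tau)$ is positive definite. Put $\Sigma_\tau:=D^2I_\tau(\hat x_\tau)^{-1}$. As $\tau\downarrow0$, the vectors $y_\tau$ and $\hat x_\tau$ converge in $\mathbb R^d$, and $\Sigma_\tau$ converges to a positive definite matrix. 2. There are constants $C_0,C_1,C_2,C_3>0$ such that $\|D^jF(x)\|_{\Sigma_\tau}\le C_j$ for $j=0,1,2,3$, all $x\in\mathbb R^d$ and all $\tau\in[0,\tau_0]$, and there is $M>0$ such that $D^3F(x)=0$ whenever $|x|>M$. Let $\mathcal L_{\mu^{y_\tau}}=\mathcal N(\hat x_\tau,\varepsilon\Sigma_\tau)$ be the Laplace approximation of $\mu^{y_\tau}$, and let $d_{\mathrm{TV}}(\nu,\mu)=\sup_B|\nu(B)-\mu(B)|$, the supremum being over all Borel sets $B$. Set $$C=\tfrac23\sqrt2\,e\,\frac{\Gamma(\frac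 d2+\frac32)}{\Gamma(\frac d2)},\qquad V(\tau)=C_3\big(\|A\|M+|y_\tau|\big)+3C_2\big\|A\Sigma_\tau^{1/2}\big\|,\qquad W=C_3C_0+3C_2C_1 .$$ Then there exists $\tau_1\in(0,\tau_0]$ such that $$d_{\mathrm{TV}}\big(\mu^{y_\tau},\mathcal L_{\mu^{y_\tau}}\big)\le C(1+\varepsilon)\varepsilon^{1/2}\Big(V(\tau)\tau+\frac W2\tau^2\Big)\qquad\text{for all }\tau\in[0,\tau_1],$$ and $\{V(\tau)\}_{\tau\in[0,\tau_1]}$ is bounded. Consequently there is a constant $L$ such that $d_{\mathrm{TV}}(\mu^{y_\tau},\mathcal L_{\mu^{y_\tau}})\le L\tau$ for all $\tau\in[0,\tau_1]$. -/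

import Mathlib

open MeasureTheory ProbabilityTheory Set Filter Topology

noncomputable section

namespace LaplaceApprox

open scoped Matrix MatrixOrder

/-- The Euclidean space of dimension `d`. -/
abbrev Vec (d : ℕ) : Type := EuclideanSpace ℝ (Fin d)

/-- The total variation distance `sup_A |ν(A) - μ(A)|` over all measurable sets `A`. -/
def tvDist {α : Type*} [MeasurableSpace α] (ν μ : Measure α) : ℝ :=
  ⨆ A : {A : Set α // MeasurableSet A}, |ν.real A - μ.real A|

/-- `x` is the unique global minimizer of `f`. -/
def IsUniqueMinimizer {α : Type*} (f : α → ℝ) (x : α) : Prop :=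
  ∀ z, z ≠ x → f x < f z

/-- The Hessian matrix `(D²f(x)(e_j, e_k))_{j,k}`. -/
def hessian {d : ℕ} (f : Vec d → ℝ) (x : Vec d) : Matrix (Fin d) (Fin d) ℝ :=
  Matrix.of fun j k =>
    iteratedFDeriv ℝ 2 f x ![EuclideanSpace.single j 1, EuclideanSpace.single k 1]

/-- The norm `‖h‖_S = |S^{-1/2} h| = (hᵀ S⁻¹ h)^{1/2}` for a positive definite matrix `S`. -/
def wnorm {d : ℕ} (S : Matrix (Fin d) (Fin d) ℝ) (h : Vec d) : ℝ :=
  √(h.ofLp ⬝ᵥ (S⁻¹ *ᵥ h.ofLp))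

/-- `‖D^j F(x)‖_S`: the supremum of `|D^j F(x)(h_1, …, h_j)|` over all `h_i` with
`‖h_i‖_S ≤ 1`. For `j = 0` this is `|F(x)|`. -/
def diffNorm {d : ℕ} (S : Matrix (Fin d) (Fin d) ℝ) (j : ℕ) (F : Vec d → Vec d) (x : Vec d) : ℝ :=
  sSup {r : ℝ | ∃ h : Fin j → Vec d, (∀ i, wnorm S (h i) ≤ 1) ∧ r = ‖iteratedFDeriv ℝ j F x h‖}

/-- The operator norm of a matrix with respect to the Euclidean norm. -/
def opNorm {d : ℕ} (A : Matrix (Fin d) (Fin d) ℝ) : ℝ :=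
  ‖Matrix.toEuclideanCLM (𝕜 := ℝ) A‖

/-- The positive semidefinite square root `S^{1/2}` of a positive semidefinite matrix. -/
def matSqrt {d : ℕ} (S : Matrix (Fin d) (Fin d) ℝ) : Matrix (Fin d) (Fin d) ℝ :=
  CFC.sqrt S

/-- The scaled negative log-likelihood `Φ(x) = |y - G(x)|² / 2`. -/
def misfit {d : ℕ} (G : Vec d → Vec d) (y : Vec d) (x : Vec d) : ℝ :=
  1 / 2 * ‖y - G x‖ ^ 2

/-- The negative log-density `R` of the Gaussian distribution `N(m, S)`. -/
def gaussianNegLogDensity {d : ℕ} (m : Vec d) (S : Matrix (Fin d) (Fin d) ℝ) (x : Vec d) : ℝ :=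
  1 / 2 * wnorm S (x - m) ^ 2 + (d : ℝ) / 2 * Real.log (2 * Real.pi) + 1 / 2 * Real.log S.det

/-- The function `I(x) = Φ(x) + ε R(x) - Φ(x̂) - ε R(x̂)`. -/
def potential {d : ℕ} (ε : ℝ) (Φ R : Vec d → ℝ) (xhat : Vec d) (x : Vec d) : ℝ :=
  Φ x + ε * R x - Φ xhat - ε * R xhat

/-- The posterior distribution: the probability measure with density proportional to
`exp(-Φ(x)/ε)` with respect to the prior. -/
def posterior {d : ℕ} (ε : ℝ) (Φ : Vec d → ℝ) (prior : Measure (Vec d)) : Measure (Vec d) :=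
  prior.tilted fun x => -(1 / ε) * Φ x

/-- The Laplace approximation `N(x̂, ε Σ)` with `Σ = D²I(x̂)⁻¹`. -/
def laplace {d : ℕ} (ε : ℝ) (I : Vec d → ℝ) (xhat : Vec d) : Measure (Vec d) :=
  multivariateGaussian xhat (ε • (hessian I xhat)⁻¹)

/-- The perturbed linear forward mapping `G_τ(x) = A x + τ F(x)`. -/
def perturbedMap {d : ℕ} (A : Matrix (Fin d) (Fin d) ℝ) (F : Vec d → Vec d) (τ : ℝ) (x : Vec d) :
    Vec d :=
  Matrix.toEuclideanLin A x + τ • F x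

/-- The function `I_τ` for the forward mapping `G_τ`, the prior `N(m₀, S₀)`, the data `y`
and the MAP estimate `xhat`. -/
def perturbedPotential {d : ℕ} (ε : ℝ) (A : Matrix (Fin d) (Fin d) ℝ) (F : Vec d → Vec d)
    (m₀ : Vec d) (S₀ : Matrix (Fin d) (Fin d) ℝ) (τ : ℝ) (y xhat : Vec d) : Vec d → ℝ :=
  potential ε (misfit (perturbedMap A F τ) y) (gaussianNegLogDensity m₀ S₀) xhat

/-- The posterior distribution for the forward mapping `G_τ`, the prior `N(m₀, S₀)` and
the data `y`. -/
def perturbedPosterior {d : ℕ} (ε : ℝ) (A : Matrix (Fin d) (Fin d) ℝ) (F : Vec d → Vec d)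
    (m₀ : Vec d) (S₀ : Matrix (Fin d) (Fin d) ℝ) (τ : ℝ) (y : Vec d) : Measure (Vec d) :=
  posterior ε (misfit (perturbedMap A F τ) y) (multivariateGaussian m₀ S₀)

/-- The constant `C = (2/3) √2 e Γ(d/2 + 3/2) / Γ(d/2)`. -/
def constC (d : ℕ) : ℝ :=
  2 / 3 * √2 * Real.exp 1 * (Real.Gamma ((d : ℝ) / 2 + 3 / 2) / Real.Gamma ((d : ℝ) / 2))

/-- `V = C₃ (‖A‖ M + |y|) + 3 C₂ ‖A S^{1/2}‖`. -/
def constV {d : ℕ} (C₂ C₃ M : ℝ) (A S : Matrix (Fin d) (Fin d) ℝ) (y : Vec d) : ℝ :=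
  C₃ * (opNorm A * M + ‖y‖) + 3 * C₂ * opNorm (A * matSqrt S)

/-- `W = C₃ C₀ + 3 C₂ C₁`. -/
def constW (C₀ C₁ C₂ C₃ : ℝ) : ℝ :=
  C₃ * C₀ + 3 * C₂ * C₁

end LaplaceApprox

end

open LaplaceApprox

/-!
With `I = I_τ`, `Σ = D²I(x̂)⁻¹` and `r` the remainder in the second order Taylor expansion of `I`
at `x̂`, the posterior is the Laplace approximation `N(x̂, εΣ)` tilted by `exp (-r/ε)`, so the
total variation distance is controlled by the expectation of `|exp (-r/ε) - 1|`. A bound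
`|r| ≤ k ‖x - x̂‖_Σ³` turns this expectation into a radial Gaussian moment, and a bound
`|r| ≤ η ‖x - x̂‖_Σ²` with `η < 1/2` keeps the exponential integrable.

Both bounds have constants of order `τ`, because `x ↦ |A x - y|²` is quadratic: every
term of `D³I` contains `τ D²F` or `τ D³F`. The only unbounded factor `A x - y` is always paired
with `D²F` or `D³F`. Since `F` is bounded and `D³F` vanishes outside a ball, `F` is quadratic along
rays leaving the ball, hence `D²F` vanishes outside the ball as well.
-/

noncomputable section

namespace LaplaceApprox

open scoped Matrix MatrixOrder

section Tilting

variable {α β : Type*} [MeasurableSpace α] [MeasurableSpace β]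

lemma tilted_add_const (μ : Measure α) (f : α → ℝ) (c : ℝ) :
    μ.tilted (fun x => f x + c) = μ.tilted f := by
  simp only [Measure.tilted, Real.exp_add, integral_mul_const,
    mul_div_mul_right _ _ (Real.exp_pos c).ne']

lemma tilted_smul_measure (μ : Measure α) (f : α → ℝ) {c : ENNReal} (hc₀ : c ≠ 0) (hc : c ≠ ⊤) :
    (c • μ).tilted f = μ.tilted f := by
  rw [Measure.tilted, Measure.tilted, withDensity_smul_measure, integral_smul_measure,
    ← withDensity_smul' _ _ hc]
  congr 1
  ext x
  have hc_pos : 0 < c.toReal := ENNReal.toReal_pos hc₀ hc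
  rw [Pi.smul_apply, smul_eq_mul, ← ENNReal.ofReal_toReal hc, ← ENNReal.ofReal_mul hc_pos.le,
    ENNReal.toReal_ofReal hc_pos.le, smul_eq_mul,
    mul_div_assoc', mul_div_mul_left _ _ hc_pos.ne']

lemma map_tilted_comp (μ : Measure α) {e : α → β} (he : MeasurableEmbedding e) (f : β → ℝ) :
    (μ.tilted (f ∘ e)).map e = (μ.map e).tilted f := by
  ext s hs
  rw [he.map_apply, tilted_apply' _ _ hs, tilted_apply' _ _ (he.measurable hs),
    he.restrict_map, he.lintegral_map, he.integral_map]
  rfl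

lemma real_tilted_sub_le {γ : Measure α} [IsProbabilityMeasure γ] {g : α → ℝ}
    (hg : Integrable (fun x => Real.exp (g x)) γ) (A : Set α) :
    |(∫ x, Real.exp (g x) ∂γ) * (γ.tilted g).real A - γ.real A| ≤
      ∫ x, |Real.exp (g x) - 1| ∂γ := by
  have hint : Integrable (fun x => Real.exp (g x) - 1) γ := hg.sub (integrable_const 1)
  have hZ : 0 < ∫ x, Real.exp (g x) ∂γ := integral_exp_pos hg
  have htilted : (∫ x, Real.exp (g x) ∂γ) * (γ.tilted g).real A = ∫ x in A, Real.exp (g x) ∂γ := by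
    rw [Measure.real, tilted_apply_eq_ofReal_integral, ENNReal.toReal_ofReal, integral_div,
      mul_div_cancel₀ _ hZ.ne']
    exact integral_nonneg fun x => div_nonneg (Real.exp_pos _).le hZ.le
  have hsub : (∫ x in A, Real.exp (g x) ∂γ) - γ.real A = ∫ x in A, (Real.exp (g x) - 1) ∂γ := by
    rw [integral_sub hg.integrableOn (integrable_const 1)]
    simp
  rw [htilted, hsub]
  exact abs_integral_le_integral_abs.trans
    (setIntegral_le_integral hint.abs (ae_of_all _ fun x => abs_nonneg _))

lemma tvDist_tilted_le {γ : Measure α} [IsProbabilityMeasure γ] {g : α → ℝ}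
    (hg : Integrable (fun x => Real.exp (g x)) γ) :
    tvDist (γ.tilted g) γ ≤ ∫ x, |Real.exp (g x) - 1| ∂γ := by
  have := isProbabilityMeasure_tilted hg
  set ν := γ.tilted g
  set Z := ∫ x, Real.exp (g x) ∂γ
  have hcompl : ∀ {A : Set α}, MeasurableSet A → ν.real Aᶜ - γ.real Aᶜ = -(ν.real A - γ.real A) :=
    fun hA => by rw [probReal_compl_eq_one_sub hA, probReal_compl_eq_one_sub hA]; ring
  have : Nonempty {A : Set α // MeasurableSet A} := ⟨⟨∅, MeasurableSet.empty⟩⟩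
  refine ciSup_le fun ⟨A, hA⟩ => ?_
  have hbound : ∀ B, |Z * ν.real B - γ.real B| ≤ ∫ x, |Real.exp (g x) - 1| ∂γ :=
    real_tilted_sub_le hg
  -- The sign of `Z - 1` makes one of the two inequalities immediate, and passing to complements
  -- yields the other.
  rcases le_total 1 Z with hZ | hZ
  · have hle : ∀ B, ν.real B - γ.real B ≤ ∫ x, |Real.exp (g x) - 1| ∂γ := fun B =>
      le_trans (sub_le_sub_right (le_mul_of_one_le_left measureReal_nonneg hZ) _)
        (le_of_abs_le (hbound B))
    exact abs_le'.2 ⟨hle A, hcompl hA ▸ hle Aᶜ⟩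
  · have hge : ∀ B, -(ν.real B - γ.real B) ≤ ∫ x, |Real.exp (g x) - 1| ∂γ := fun B =>
      le_trans (neg_le_neg (sub_le_sub_right (mul_le_of_le_one_left measureReal_nonneg hZ) _))
        (neg_le_of_neg_le (neg_le_of_abs_le (hbound B)))
    exact abs_le'.2 ⟨neg_neg (ν.real A - γ.real A) ▸ hcompl hA ▸ hge Aᶜ, hge A⟩

end Tilting

lemma abs_exp_sub_one_le_mul_exp_abs (x : ℝ) : |Real.exp x - 1| ≤ |x| * Real.exp |x| := by
  have h := Complex.norm_exp_sub_sum_le_norm_mul_exp x 1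
  simp only [Finset.sum_range_one, pow_zero, Nat.factorial_zero, Nat.cast_one, div_one,
    pow_one, Complex.norm_real, Real.norm_eq_abs] at h
  exact_mod_cast h

section RadialMoments

lemma pow_pred_smul_pow_mul_exp {k : ℕ} (hk : 0 < k) (n : ℕ) (b y : ℝ) :
    y ^ (k - 1) • (y ^ n * Real.exp (-b * y ^ 2)) =
      y ^ ((k : ℝ) + n - 1) * Real.exp (-b * y ^ (2 : ℝ)) := by
  have h : (k : ℝ) + n - 1 = (k - 1 + n : ℕ) := by
    rw [Nat.cast_add, Nat.cast_pred hk]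
    ring
  rw [h, Real.rpow_natCast, Real.rpow_two, pow_add, smul_eq_mul, mul_assoc]

lemma neg_one_lt_add_natCast_sub_one {k : ℕ} (hk : 0 < k) (n : ℕ) : -1 < (k : ℝ) + n - 1 := by
  have : (0 : ℝ) < k := Nat.cast_pos.2 hk
  have : (0 : ℝ) ≤ n := n.cast_nonneg
  linarith

variable {E : Type*} [NormedAddCommGroup E] [NormedSpace ℝ E] [FiniteDimensional ℝ E]
  [Nontrivial E] [MeasurableSpace E] [BorelSpace E]

open Module (finrank finrank_pos)

variable (μ : Measure E) [μ.IsAddHaarMeasure]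

lemma integral_norm_pow_mul_exp_neg_mul_sq (n : ℕ) {b : ℝ} (hb : 0 < b) :
    ∫ z, ‖z‖ ^ n * Real.exp (-b * ‖z‖ ^ 2) ∂μ =
      finrank ℝ E * μ.real (Metric.ball 0 1) *
        (b ^ (-((finrank ℝ E : ℝ) + n) / 2) * (1 / 2) *
          Real.Gamma (((finrank ℝ E : ℝ) + n) / 2)) := by
  rw [integral_fun_norm_addHaar μ fun y => y ^ n * Real.exp (-b * y ^ 2)]
  simp only [pow_pred_smul_pow_mul_exp finrank_pos]
  rw [integral_rpow_mul_exp_neg_mul_rpow two_pos (neg_one_lt_add_natCast_sub_one finrank_pos n) hb,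
    sub_add_cancel, nsmul_eq_mul, smul_eq_mul, ← mul_assoc]

lemma integrable_norm_pow_mul_exp_neg_mul_sq (n : ℕ) {b : ℝ} (hb : 0 < b) :
    Integrable (fun z => ‖z‖ ^ n * Real.exp (-b * ‖z‖ ^ 2)) μ := by
  refine (integrable_fun_norm_addHaar μ (f := fun y => y ^ n * Real.exp (-b * y ^ 2))).2 ?_
  simp only [pow_pred_smul_pow_mul_exp finrank_pos, Real.rpow_two]
  exact (integrable_rpow_mul_exp_neg_mul_sq hb
    (neg_one_lt_add_natCast_sub_one finrank_pos n)).integrableOn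

end RadialMoments

section StdGaussian

lemma exp_mul_pow_mul_exp (n : ℕ) (η r : ℝ) :
    Real.exp (-(1 / 2) * r ^ 2) * (r ^ n * Real.exp (η * r ^ 2)) =
      r ^ n * Real.exp (-(1 / 2 - η) * r ^ 2) := by
  rw [mul_left_comm, ← Real.exp_add]
  ring_nf

variable {E : Type*} [NormedAddCommGroup E] [InnerProductSpace ℝ E] [FiniteDimensional ℝ E]
  [MeasurableSpace E] [BorelSpace E]

open Module (finrank)

lemma integrable_exp_neg_half_mul_norm_sq :
    Integrable fun z : E => Real.exp (-(1 / 2) * ‖z‖ ^ 2) := by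
  have h := (GaussianFourier.integrable_cexp_neg_mul_sq_norm_add (V := E)
    (b := (1 / 2 : ℂ)) (by norm_num) 0 0).re
  refine h.congr (ae_of_all _ fun z => ?_)
  simp only [zero_mul, add_zero, RCLike.re_to_complex]
  rw [← Complex.exp_ofReal_re]
  push_cast
  rfl

lemma stdGaussian_eq_tilted :
    stdGaussian E = (volume : Measure E).tilted fun z => -(1 / 2) * ‖z‖ ^ 2 := by
  have := isProbabilityMeasure_tilted (integrable_exp_neg_half_mul_norm_sq (E := E))
  refine Measure.ext_of_charFun (funext fun t => ?_)
  rw [charFun_stdGaussian, charFun_apply, integral_tilted,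
    GaussianFourier.integral_rexp_neg_mul_sq_norm (by norm_num : (0 : ℝ) < 1 / 2)]
  set Z : ℝ := (Real.pi / (1 / 2)) ^ (finrank ℝ E / 2 : ℝ) with hZ
  have hZ₀ : (Z : ℂ) ≠ 0 := Complex.ofReal_ne_zero.2 (by positivity)
  have hZ_complex : ((Real.pi : ℂ) / (1 / 2)) ^ ((finrank ℝ E : ℂ) / 2) = Z := by
    rw [hZ, Complex.ofReal_cpow (by positivity)]
    push_cast
    rfl
  have hintegrand : ∀ z : E, (Real.exp (-(1 / 2) * ‖z‖ ^ 2) / Z) •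
      Complex.exp ((inner ℝ z t : ℝ) * Complex.I) =
      (Z : ℂ)⁻¹ * Complex.exp (-(1 / 2 : ℂ) * ‖z‖ ^ 2 + Complex.I * (inner ℝ t z : ℝ)) := by
    intro z
    rw [Complex.real_smul, Complex.exp_add, real_inner_comm]
    push_cast
    ring_nf
  simp only [hintegrand]
  rw [integral_const_mul, GaussianFourier.integral_cexp_neg_mul_sq_norm_add (by norm_num),
    hZ_complex, ← mul_assoc, inv_mul_cancel₀ hZ₀, one_mul, Complex.I_sq]
  ring_nf

variable [Nontrivial E]

lemma integrable_stdGaussian_norm_pow_mul_exp (n : ℕ) {η : ℝ} (hη : η < 1 / 2) :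
    Integrable (fun z => ‖z‖ ^ n * Real.exp (η * ‖z‖ ^ 2)) (stdGaussian E) := by
  rw [stdGaussian_eq_tilted, integrable_tilted_iff integrable_exp_neg_half_mul_norm_sq]
  simp only [smul_eq_mul, exp_mul_pow_mul_exp]
  exact integrable_norm_pow_mul_exp_neg_mul_sq volume n (by linarith)

lemma integral_stdGaussian_norm_pow_mul_exp (n : ℕ) {η : ℝ} (hη : η < 1 / 2) :
    ∫ z, ‖z‖ ^ n * Real.exp (η * ‖z‖ ^ 2) ∂(stdGaussian E) =
      (1 - 2 * η) ^ (-((finrank ℝ E : ℝ) + n) / 2) * 2 ^ ((n : ℝ) / 2) *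
        (Real.Gamma (((finrank ℝ E : ℝ) + n) / 2) / Real.Gamma ((finrank ℝ E : ℝ) / 2)) := by
  have hmass : ∫ z : E, Real.exp (-(1 / 2) * ‖z‖ ^ 2) =
      finrank ℝ E * volume.real (Metric.ball (0 : E) 1) *
        ((1 / 2) ^ (-(finrank ℝ E : ℝ) / 2) * (1 / 2) * Real.Gamma ((finrank ℝ E : ℝ) / 2)) := by
    simpa using integral_norm_pow_mul_exp_neg_mul_sq (volume : Measure E) 0 one_half_pos
  have hball : 0 < volume.real (Metric.ball (0 : E) 1) :=
    ENNReal.toReal_pos (Metric.measure_ball_pos _ _ one_pos).ne' measure_ball_lt_top.ne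
  have hdim : (0 : ℝ) < finrank ℝ E := Nat.cast_pos.2 Module.finrank_pos
  have : 0 < Real.Gamma ((finrank ℝ E : ℝ) / 2) := Real.Gamma_pos_of_pos (by positivity)
  have hscale : (1 / 2 - η) ^ (-((finrank ℝ E : ℝ) + n) / 2) =
      (1 - 2 * η) ^ (-((finrank ℝ E : ℝ) + n) / 2) * 2 ^ ((n : ℝ) / 2) *
        (1 / 2) ^ (-(finrank ℝ E : ℝ) / 2) := by
    have hexp : -((finrank ℝ E : ℝ) + n) / 2 = -((n : ℝ) / 2) + -(finrank ℝ E : ℝ) / 2 := by ring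
    have hhalf : (1 / 2 - η) = (1 - 2 * η) * (1 / 2) := by ring
    have htwo : ((1 : ℝ) / 2) ^ (-((n : ℝ) / 2)) = 2 ^ ((n : ℝ) / 2) := by
      rw [one_div, Real.inv_rpow two_pos.le, ← Real.rpow_neg two_pos.le, neg_neg]
    rw [hhalf, Real.mul_rpow (by linarith) (by norm_num), mul_assoc, ← htwo,
      ← Real.rpow_add one_half_pos, ← hexp]
  have : (0 : ℝ) < (1 / 2) ^ (-(finrank ℝ E : ℝ) / 2) := by positivity
  simp only [stdGaussian_eq_tilted, integral_tilted, smul_eq_mul, div_mul_eq_mul_div,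
    exp_mul_pow_mul_exp]
  rw [integral_div, integral_norm_pow_mul_exp_neg_mul_sq volume n (by linarith), hmass, hscale]
  field_simp

end StdGaussian

section GaussianTilting

variable {E : Type*} [NormedAddCommGroup E] [InnerProductSpace ℝ E] [FiniteDimensional ℝ E]
  [Nontrivial E] [MeasurableSpace E] [BorelSpace E]

lemma integrable_exp_stdGaussian {g : E → ℝ} (hg : AEStronglyMeasurable g (stdGaussian E))
    {η : ℝ} (hη : η < 1 / 2) (hsq : ∀ z, |g z| ≤ η * ‖z‖ ^ 2) :
    Integrable (fun z => Real.exp (g z)) (stdGaussian E) := by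
  refine (integrable_stdGaussian_norm_pow_mul_exp 0 hη).mono'
    (Real.continuous_exp.comp_aestronglyMeasurable hg) (ae_of_all _ fun z => ?_)
  rw [pow_zero, one_mul, Real.norm_of_nonneg (Real.exp_pos _).le]
  exact Real.exp_le_exp.2 ((le_abs_self _).trans (hsq z))

lemma integral_abs_exp_sub_one_stdGaussian_le {g : E → ℝ} {k η : ℝ} (n : ℕ) (hη : η < 1 / 2)
    (hpow : ∀ z, |g z| ≤ k * ‖z‖ ^ n) (hsq : ∀ z, |g z| ≤ η * ‖z‖ ^ 2) :
    ∫ z, |Real.exp (g z) - 1| ∂(stdGaussian E) ≤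
      k * ∫ z, ‖z‖ ^ n * Real.exp (η * ‖z‖ ^ 2) ∂(stdGaussian E) := by
  rw [← integral_const_mul]
  refine integral_mono_of_nonneg (ae_of_all _ fun z => abs_nonneg _)
    ((integrable_stdGaussian_norm_pow_mul_exp n hη).const_mul k) (ae_of_all _ fun z => ?_)
  calc |Real.exp (g z) - 1| ≤ |g z| * Real.exp |g z| := abs_exp_sub_one_le_mul_exp_abs _
    _ ≤ k * ‖z‖ ^ n * Real.exp (η * ‖z‖ ^ 2) :=
        mul_le_mul (hpow z) (Real.exp_le_exp.2 (hsq z)) (Real.exp_pos _).le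
          ((abs_nonneg _).trans (hpow z))
    _ = k * (‖z‖ ^ n * Real.exp (η * ‖z‖ ^ 2)) := mul_assoc _ _ _

end GaussianTilting

section WeightedNorm

variable {d : ℕ} {S : Matrix (Fin d) (Fin d) ℝ}

lemma isUnit_matSqrt (hS : S.PosDef) : IsUnit (matSqrt S) :=
  (CFC.isUnit_sqrt_iff S hS.posSemidef.nonneg).2 hS.isUnit

lemma matSqrt_transpose (S : Matrix (Fin d) (Fin d) ℝ) : (matSqrt S)ᵀ = matSqrt S := by
  have h := (CFC.sqrt_nonneg S).isSelfAdjoint.star_eq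
  rwa [Matrix.star_eq_conjTranspose, Matrix.conjTranspose_eq_transpose_of_trivial] at h

lemma matSqrt_mul_inv_mul_matSqrt (hS : S.PosDef) : matSqrt S * S⁻¹ * matSqrt S = 1 := by
  have hdet := (Matrix.isUnit_iff_isUnit_det _).1 (isUnit_matSqrt hS)
  have hsq : matSqrt S * matSqrt S = S := CFC.sqrt_mul_sqrt_self S hS.posSemidef.nonneg
  rw [← congrArg Inv.inv hsq, Matrix.mul_inv_rev, ← mul_assoc, Matrix.mul_nonsing_inv _ hdet,
    one_mul, Matrix.nonsing_inv_mul _ hdet]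

/-- The linear automorphism `z ↦ S^{1/2} z`, which by `wnorm_sqrtEquiv` carries the Euclidean norm
to `‖·‖_S`. -/
def sqrtEquiv (hS : S.PosDef) : Vec d ≃L[ℝ] Vec d :=
  ContinuousLinearEquiv.unitsEquiv ℝ (Vec d)
    ((isUnit_matSqrt hS).map (Matrix.toEuclideanCLM (n := Fin d) (𝕜 := ℝ))).unit

lemma wnorm_sqrtEquiv (hS : S.PosDef) (z : Vec d) : wnorm S (sqrtEquiv hS z) = ‖z‖ := by
  have h : (sqrtEquiv hS z).ofLp = matSqrt S *ᵥ z.ofLp := Matrix.ofLp_toEuclideanCLM _ _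
  rw [wnorm, h, Matrix.mulVec_mulVec, ← Matrix.vecMul_transpose, matSqrt_transpose,
    ← Matrix.dotProduct_mulVec, Matrix.mulVec_mulVec, ← mul_assoc,
    matSqrt_mul_inv_mul_matSqrt hS, Matrix.one_mulVec, EuclideanSpace.norm_eq]
  simp [dotProduct, sq]

lemma wnorm_eq_norm_symm (hS : S.PosDef) (h : Vec d) : wnorm S h = ‖(sqrtEquiv hS).symm h‖ := by
  rw [← wnorm_sqrtEquiv hS, ContinuousLinearEquiv.apply_symm_apply]

lemma wnorm_nonneg (S : Matrix (Fin d) (Fin d) ℝ) (h : Vec d) : 0 ≤ wnorm S h := Real.sqrt_nonneg _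

lemma continuous_wnorm (S : Matrix (Fin d) (Fin d) ℝ) : Continuous (wnorm S) := by
  unfold wnorm
  simp only [dotProduct, Matrix.mulVec]
  fun_prop

lemma wnorm_eq_sqrt_mul_wnorm_smul (hS : S.PosDef) {ε : ℝ} (hε : 0 < ε) (h : Vec d) :
    wnorm S h = √ε * wnorm (ε • S) h := by
  have hinv : (ε • S)⁻¹ = ε⁻¹ • S⁻¹ :=
    Matrix.inv_smul' S (Units.mk0 ε hε.ne') ((Matrix.isUnit_iff_isUnit_det _).1 hS.isUnit)
  rw [wnorm, wnorm, hinv, Matrix.smul_mulVec, dotProduct_smul, smul_eq_mul, ← Real.sqrt_mul hε.le,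
    mul_inv_cancel_left₀ hε.ne']

lemma norm_toEuclideanLin_le_opNorm_mul_matSqrt (A : Matrix (Fin d) (Fin d) ℝ) (hS : S.PosDef)
    (v : Vec d) : ‖Matrix.toEuclideanLin A v‖ ≤ opNorm (A * matSqrt S) * wnorm S v := by
  obtain ⟨z, rfl⟩ := (sqrtEquiv hS).surjective v
  rw [wnorm_sqrtEquiv hS, opNorm, map_mul]
  exact ContinuousLinearMap.le_opNorm
    (Matrix.toEuclideanCLM (𝕜 := ℝ) A * Matrix.toEuclideanCLM (𝕜 := ℝ) (matSqrt S)) z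

lemma opNorm_mul_matSqrt_le {A : Matrix (Fin d) (Fin d) ℝ} (hS : S.PosDef) {c : ℝ} (hc : 0 ≤ c)
    (h : ∀ v, ‖Matrix.toEuclideanLin A v‖ ≤ c * wnorm S v) : opNorm (A * matSqrt S) ≤ c := by
  refine ContinuousLinearMap.opNorm_le_bound _ hc fun z => ?_
  rw [map_mul, ← wnorm_sqrtEquiv hS z]
  exact h (sqrtEquiv hS z)

end WeightedNorm

section MultivariateGaussian

variable {d : ℕ} {S : Matrix (Fin d) (Fin d) ℝ}

/-- The affine map `z ↦ m + S^{1/2} z`, which carries the standard Gaussian measure to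
`N(m, S)`. -/
def gaussianHomeomorph (m : Vec d) (hS : S.PosDef) : Vec d ≃ₜ Vec d :=
  (sqrtEquiv hS).toHomeomorph.trans (Homeomorph.addLeft m)

lemma multivariateGaussian_eq_map (m : Vec d) (hS : S.PosDef) :
    multivariateGaussian m S = (stdGaussian (Vec d)).map (gaussianHomeomorph m hS) := rfl

lemma wnorm_gaussianHomeomorph_sub (m : Vec d) (hS : S.PosDef) (z : Vec d) :
    wnorm S (gaussianHomeomorph m hS z - m) = ‖z‖ := by
  rw [← wnorm_sqrtEquiv hS z]
  exact congrArg (wnorm S) (add_sub_cancel_left m _)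

lemma map_volume_gaussianHomeomorph (m : Vec d) (hS : S.PosDef) :
    (volume : Measure (Vec d)).map (gaussianHomeomorph m hS) =
      ENNReal.ofReal |(LinearMap.det (sqrtEquiv hS : Vec d →ₗ[ℝ] Vec d))⁻¹| • volume := by
  have hdet : LinearMap.det (sqrtEquiv hS : Vec d →ₗ[ℝ] Vec d) ≠ 0 :=
    (LinearEquiv.isUnit_det' (sqrtEquiv hS).toLinearEquiv).ne_zero
  have hcomp : ⇑(gaussianHomeomorph m hS) =
      (fun x => m + x) ∘ (sqrtEquiv hS : Vec d →ₗ[ℝ] Vec d) := rfl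
  rw [hcomp, ← Measure.map_map (measurable_const_add m)
      (LinearMap.continuous_of_finiteDimensional _).measurable,
    Measure.map_linearMap_addHaar_eq_smul_addHaar _ hdet, Measure.map_smul,
    (measurePreserving_add_left volume m).map_eq]

lemma multivariateGaussian_eq_tilted (m : Vec d) (hS : S.PosDef) :
    multivariateGaussian m S =
      (volume : Measure (Vec d)).tilted fun x => -(1 / 2) * wnorm S (x - m) ^ 2 := by
  have hdet : LinearMap.det (sqrtEquiv hS : Vec d →ₗ[ℝ] Vec d) ≠ 0 :=
    (LinearEquiv.isUnit_det' (sqrtEquiv hS).toLinearEquiv).ne_zero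
  have hcomp : (fun z : Vec d => -(1 / 2) * ‖z‖ ^ 2) =
      (fun x => -(1 / 2) * wnorm S (x - m) ^ 2) ∘ gaussianHomeomorph m hS := by
    ext z
    rw [Function.comp_apply, wnorm_gaussianHomeomorph_sub]
  rw [multivariateGaussian_eq_map m hS, stdGaussian_eq_tilted, hcomp,
    map_tilted_comp _ (gaussianHomeomorph m hS).measurableEmbedding,
    map_volume_gaussianHomeomorph,
    tilted_smul_measure _ _ (by simpa using hdet) ENNReal.ofReal_ne_top]

lemma integrable_exp_neg_half_mul_wnorm_sq (m : Vec d) (hS : S.PosDef) :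
    Integrable fun x => Real.exp (-(1 / 2) * wnorm S (x - m) ^ 2) := by
  by_contra h
  refine IsProbabilityMeasure.ne_zero (multivariateGaussian m S) ?_
  rw [multivariateGaussian_eq_tilted m hS, tilted_of_not_integrable h]

lemma tvDist_tilted_multivariateGaussian_le (hd : 0 < d) (m : Vec d) (hS : S.PosDef)
    {g : Vec d → ℝ} (hg : Continuous g) {k η : ℝ} (n : ℕ) (hη : η < 1 / 2)
    (hpow : ∀ x, |g x| ≤ k * wnorm S (x - m) ^ n)
    (hsq : ∀ x, |g x| ≤ η * wnorm S (x - m) ^ 2) :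
    tvDist ((multivariateGaussian m S).tilted g) (multivariateGaussian m S) ≤
      k * ((1 - 2 * η) ^ (-((d : ℝ) + n) / 2) * 2 ^ ((n : ℝ) / 2) *
        (Real.Gamma (((d : ℝ) + n) / 2) / Real.Gamma ((d : ℝ) / 2))) := by
  have : Nonempty (Fin d) := ⟨⟨0, hd⟩⟩
  set e := gaussianHomeomorph m hS
  have he := e.measurableEmbedding
  have hpow' : ∀ z, |g (e z)| ≤ k * ‖z‖ ^ n := fun z =>
    wnorm_gaussianHomeomorph_sub m hS z ▸ hpow (e z)
  have hsq' : ∀ z, |g (e z)| ≤ η * ‖z‖ ^ 2 := fun z =>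
    wnorm_gaussianHomeomorph_sub m hS z ▸ hsq (e z)
  have hint : Integrable (fun x => Real.exp (g x)) (multivariateGaussian m S) := by
    rw [multivariateGaussian_eq_map m hS, he.integrable_map_iff]
    exact integrable_exp_stdGaussian (hg.comp e.continuous).aestronglyMeasurable hη hsq'
  refine (tvDist_tilted_le hint).trans ?_
  rw [multivariateGaussian_eq_map m hS, he.integral_map]
  simpa only [integral_stdGaussian_norm_pow_mul_exp n hη, finrank_euclideanSpace_fin] using
    integral_abs_exp_sub_one_stdGaussian_le n hη hpow' hsq'

end MultivariateGaussian

section Posterior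

variable {d : ℕ}

/-- The error of the second-order Taylor approximation at `x̂` of a function `f` that vanishes
together with its first derivative at `x̂`. The quadratic term is written with the norm `‖·‖_Σ` for
`Σ = D²f(x̂)⁻¹`. -/
def quadraticRemainder (f : Vec d → ℝ) (xhat x : Vec d) : ℝ :=
  f x - 1 / 2 * wnorm (hessian f xhat)⁻¹ (x - xhat) ^ 2

variable {ε : ℝ} {Φ : Vec d → ℝ} {m₀ xhat : Vec d} {S₀ : Matrix (Fin d) (Fin d) ℝ}

lemma posterior_eq_tilted_laplace (hε : 0 < ε) (hS₀ : S₀.PosDef)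
    (hpos : (hessian (potential ε Φ (gaussianNegLogDensity m₀ S₀) xhat) xhat).PosDef) :
    posterior ε Φ (multivariateGaussian m₀ S₀) =
      (laplace ε (potential ε Φ (gaussianNegLogDensity m₀ S₀) xhat) xhat).tilted fun x => -(1 / ε) *
        quadraticRemainder (potential ε Φ (gaussianNegLogDensity m₀ S₀) xhat) xhat x := by
  set I := potential ε Φ (gaussianNegLogDensity m₀ S₀) xhat with hI
  have hεS : (ε • (hessian I xhat)⁻¹).PosDef := hpos.inv.smul hε
  rw [posterior, multivariateGaussian_eq_tilted m₀ hS₀,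
    tilted_tilted (integrable_exp_neg_half_mul_wnorm_sq m₀ hS₀), laplace,
    multivariateGaussian_eq_tilted xhat hεS,
    tilted_tilted (integrable_exp_neg_half_mul_wnorm_sq xhat hεS),
    ← tilted_add_const _ _ (1 / ε * Φ xhat + 1 / 2 * wnorm S₀ (xhat - m₀) ^ 2)]
  congr 1
  funext x
  simp only [Pi.add_apply, quadraticRemainder, wnorm_eq_sqrt_mul_wnorm_smul hpos.inv hε, mul_pow,
    Real.sq_sqrt hε.le]
  simp only [hI, potential, gaussianNegLogDensity]
  field_simp
  ring

lemma continuous_gaussianNegLogDensity (m₀ : Vec d) (S₀ : Matrix (Fin d) (Fin d) ℝ) :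
    Continuous (gaussianNegLogDensity m₀ S₀) := by
  have := continuous_wnorm S₀
  unfold gaussianNegLogDensity
  fun_prop

lemma continuous_quadraticRemainder {f : Vec d → ℝ} (hf : Continuous f) (xhat : Vec d) :
    Continuous (quadraticRemainder f xhat) := by
  have := continuous_wnorm (hessian f xhat)⁻¹
  unfold quadraticRemainder
  fun_prop

lemma constC_eq (d : ℕ) :
    3 * constC d = Real.exp 1 * 2 ^ ((3 : ℝ) / 2) *
      (Real.Gamma (((d : ℝ) + 3) / 2) / Real.Gamma ((d : ℝ) / 2)) := by
  have hpow : (2 : ℝ) ^ ((3 : ℝ) / 2) = 2 * √2 := by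
    rw [show (3 / 2 : ℝ) = 1 + 1 / 2 by norm_num, Real.rpow_add two_pos, Real.rpow_one,
      ← Real.sqrt_eq_rpow]
  rw [constC, hpow, add_div]
  ring

lemma tvDist_posterior_laplace_le (hd : 0 < d) (hε : 0 < ε) (hΦ : Continuous Φ) (hS₀ : S₀.PosDef)
    (hpos : (hessian (potential ε Φ (gaussianNegLogDensity m₀ S₀) xhat) xhat).PosDef)
    {k η : ℝ} (hk : 0 ≤ k) (hη : η < 1 / 2)
    (hηe : (1 - 2 * η) ^ (-((d : ℝ) + 3) / 2) ≤ Real.exp 1)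
    (hcube : ∀ x, |quadraticRemainder (potential ε Φ (gaussianNegLogDensity m₀ S₀) xhat) xhat x| ≤
      k * wnorm (hessian (potential ε Φ (gaussianNegLogDensity m₀ S₀) xhat) xhat)⁻¹
        (x - xhat) ^ 3)
    (hsq : ∀ x, |quadraticRemainder (potential ε Φ (gaussianNegLogDensity m₀ S₀) xhat) xhat x| ≤
      η * wnorm (hessian (potential ε Φ (gaussianNegLogDensity m₀ S₀) xhat) xhat)⁻¹
        (x - xhat) ^ 2) :
    tvDist (posterior ε Φ (multivariateGaussian m₀ S₀))
        (laplace ε (potential ε Φ (gaussianNegLogDensity m₀ S₀) xhat) xhat) ≤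
      constC d * √ε * (3 * k) := by
  rw [posterior_eq_tilted_laplace hε hS₀ hpos]
  set I := potential ε Φ (gaussianNegLogDensity m₀ S₀) xhat
  have hI : Continuous I := by
    have := continuous_gaussianNegLogDensity m₀ S₀
    unfold I potential
    fun_prop
  have habs : ∀ x, |-(1 / ε) * quadraticRemainder I xhat x| =
      ε⁻¹ * |quadraticRemainder I xhat x| := fun x => by
    rw [abs_mul, abs_neg, one_div, abs_of_pos (inv_pos.2 hε)]
  have hscale : ∀ x, wnorm (hessian I xhat)⁻¹ x = √ε * wnorm (ε • (hessian I xhat)⁻¹) x :=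
    wnorm_eq_sqrt_mul_wnorm_smul hpos.inv hε
  have hsqrt : ε⁻¹ * √ε ^ 2 = 1 := by rw [Real.sq_sqrt hε.le, inv_mul_cancel₀ hε.ne']
  refine (tvDist_tilted_multivariateGaussian_le hd xhat (hpos.inv.smul hε)
    ((continuous_quadraticRemainder hI xhat).const_mul _) (k := √ε * k) 3 hη
    (fun x => ?_) fun x => ?_).trans ?_
  · calc |-(1 / ε) * quadraticRemainder I xhat x|
        ≤ ε⁻¹ * (k * (√ε * wnorm (ε • (hessian I xhat)⁻¹) (x - xhat)) ^ 3) := by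
          rw [habs, ← hscale]
          gcongr
          exact hcube x
      _ = ε⁻¹ * √ε ^ 2 * (√ε * k * wnorm (ε • (hessian I xhat)⁻¹) (x - xhat) ^ 3) := by ring
      _ = √ε * k * wnorm (ε • (hessian I xhat)⁻¹) (x - xhat) ^ 3 := by rw [hsqrt, one_mul]
  · calc |-(1 / ε) * quadraticRemainder I xhat x|
        ≤ ε⁻¹ * (η * (√ε * wnorm (ε • (hessian I xhat)⁻¹) (x - xhat)) ^ 2) := by
          rw [habs, ← hscale]
          gcongr
          exact hsq x
      _ = ε⁻¹ * √ε ^ 2 * (η * wnorm (ε • (hessian I xhat)⁻¹) (x - xhat) ^ 2) := by ring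
      _ = η * wnorm (ε • (hessian I xhat)⁻¹) (x - xhat) ^ 2 := by rw [hsqrt, one_mul]
  · have : 0 ≤ Real.Gamma (((d : ℝ) + 3) / 2) / Real.Gamma ((d : ℝ) / 2) :=
      div_nonneg (Real.Gamma_nonneg_of_nonneg (by positivity))
        (Real.Gamma_nonneg_of_nonneg (by positivity))
    calc √ε * k * ((1 - 2 * η) ^ (-((d : ℝ) + (3 : ℕ)) / 2) * 2 ^ (((3 : ℕ) : ℝ) / 2) *
          (Real.Gamma (((d : ℝ) + (3 : ℕ)) / 2) / Real.Gamma ((d : ℝ) / 2)))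
        ≤ √ε * k * (Real.exp 1 * 2 ^ ((3 : ℝ) / 2) *
          (Real.Gamma (((d : ℝ) + 3) / 2) / Real.Gamma ((d : ℝ) / 2))) := by
          rw [Nat.cast_ofNat]
          gcongr
      _ = constC d * √ε * (3 * k) := by
          rw [← constC_eq]
          ring

end Posterior

section DirectionalDerivatives

variable {E G : Type*} [NormedAddCommGroup E] [NormedSpace ℝ E] [NormedAddCommGroup G]

section Taylor

variable [NormedSpace ℝ G]

lemma norm_sub_taylor_sum_le [CompleteSpace G] {f : E → G} (n : ℕ) (hf : ContDiff ℝ (n + 1) f)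
    (x v : E) (w : G) {c : ℝ}
    (hc : ∀ t ∈ Icc (0 : ℝ) 1, ‖iteratedFDeriv ℝ (n + 1) f (x + t • v) (fun _ => v) - w‖ ≤ c) :
    ‖f (x + v) - (∑ k ∈ Finset.range (n + 1),
        ((k.factorial : ℝ)⁻¹ • iteratedFDeriv ℝ k f x fun _ => v) +
        ((n + 1).factorial : ℝ)⁻¹ • w)‖ ≤ c / (n + 1).factorial := by
  have hweight : ∫ t in (0 : ℝ)..1, (1 - t) ^ n = ((n : ℝ) + 1)⁻¹ := by
    simp [intervalIntegral.integral_comp_sub_left (fun t : ℝ => t ^ n), integral_pow]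
  have hfact : ((n + 1).factorial : ℝ)⁻¹ = (n.factorial : ℝ)⁻¹ * ((n : ℝ) + 1)⁻¹ := by
    rw [Nat.factorial_succ, Nat.cast_mul, mul_inv, mul_comm, Nat.cast_add_one]
  have hderiv : Continuous fun t : ℝ =>
      (1 - t) ^ n • iteratedFDeriv ℝ (n + 1) f (x + t • v) fun _ => v := by
    have := hf.continuous_iteratedFDeriv (m := n + 1) (by exact_mod_cast le_rfl)
    fun_prop
  have hconst : Continuous fun t : ℝ => (1 - t) ^ n • w := by fun_prop
  have hrem : f (x + v) - (∑ k ∈ Finset.range (n + 1),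
        ((k.factorial : ℝ)⁻¹ • iteratedFDeriv ℝ k f x fun _ => v) +
        ((n + 1).factorial : ℝ)⁻¹ • w) = (n.factorial : ℝ)⁻¹ • ∫ t in (0 : ℝ)..1,
          (1 - t) ^ n • (iteratedFDeriv ℝ (n + 1) f (x + t • v) (fun _ => v) - w) := by
    simp_rw [smul_sub]
    rw [map_add_eq_sum_add_integral_iteratedFDeriv fun t _ => hf.contDiffAt,
      add_sub_add_left_eq_sub, intervalIntegral.integral_sub (hderiv.intervalIntegrable _ _)
        (hconst.intervalIntegrable _ _), intervalIntegral.integral_smul_const, hweight, smul_sub,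
      hfact, mul_smul]
  have hint : ‖∫ t in (0 : ℝ)..1,
      (1 - t) ^ n • (iteratedFDeriv ℝ (n + 1) f (x + t • v) (fun _ => v) - w)‖ ≤
        ∫ t in (0 : ℝ)..1, (1 - t) ^ n * c := by
    refine intervalIntegral.norm_integral_le_of_norm_le zero_le_one
      (ae_of_all _ fun t ht => ?_) (Continuous.intervalIntegrable (by fun_prop) _ _)
    have h1t : 0 ≤ 1 - t := sub_nonneg.2 ht.2
    rw [norm_smul, Real.norm_of_nonneg (pow_nonneg h1t n)]
    gcongr
    exact hc t ⟨ht.1.le, ht.2⟩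
  rw [hrem, norm_smul, norm_inv, Real.norm_natCast, div_eq_inv_mul, hfact, mul_assoc]
  gcongr
  rwa [intervalIntegral.integral_mul_const, hweight] at hint

lemma iteratedFDeriv_apply_smul (f : E → G) (n : ℕ) (x : E) (t : ℝ) (v : E) :
    (iteratedFDeriv ℝ n f x fun _ => t • v) = t ^ n • iteratedFDeriv ℝ n f x fun _ => v := by
  simpa using (iteratedFDeriv ℝ n f x).map_smul_univ (fun _ => t) fun _ => v

lemma map_add_smul_eq_of_iteratedFDeriv_three_eq_zero [CompleteSpace G] {f : E → G}
    (hf : ContDiff ℝ 3 f) {x v : E}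
    (h : ∀ t : ℝ, 0 ≤ t → iteratedFDeriv ℝ 3 f (x + t • v) = 0) {t : ℝ} (ht : 0 ≤ t) :
    f (x + t • v) = f x + t • fderiv ℝ f x v +
      (t ^ 2 / 2) • iteratedFDeriv ℝ 2 f x fun _ => v := by
  have htaylor := norm_sub_taylor_sum_le 2 (by exact_mod_cast hf) x (t • v) (0 : G) (c := 0)
    fun s hs => by simp [smul_smul, h (s * t) (mul_nonneg hs.1 ht)]
  rw [zero_div, norm_le_zero_iff, sub_eq_zero] at htaylor
  rw [htaylor]
  simp [Finset.sum_range_succ, iteratedFDeriv_apply_smul, smul_smul, div_eq_inv_mul]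

lemma iteratedFDeriv_two_eq_zero_of_ray [CompleteSpace G] {f : E → G}
    (hf : ContDiff ℝ 3 f) {c : ℝ} (hc : ∀ x, ‖f x‖ ≤ c) {x v : E}
    (h : ∀ t : ℝ, 0 ≤ t → iteratedFDeriv ℝ 3 f (x + t • v) = 0) :
    (iteratedFDeriv ℝ 2 f x fun _ => v) = 0 := by
  set w := iteratedFDeriv ℝ 2 f x fun _ => v with hw
  have hbound : ∀ t : ℝ, 0 ≤ t → t ^ 2 * ‖w‖ ≤ 4 * c := fun t ht => by
    have hdiff : t ^ 2 • w = f (x + (2 * t) • v) - (f (x + t • v) + f (x + t • v)) + f x := by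
      rw [map_add_smul_eq_of_iteratedFDeriv_three_eq_zero hf h ht,
        map_add_smul_eq_of_iteratedFDeriv_three_eq_zero hf h (mul_nonneg zero_le_two ht), ← hw]
      module
    have hnorm := congrArg norm hdiff
    rw [norm_smul, Real.norm_of_nonneg (sq_nonneg t)] at hnorm
    rw [hnorm]
    linarith [norm_add_le (f (x + (2 * t) • v) - (f (x + t • v) + f (x + t • v))) (f x),
      norm_sub_le (f (x + (2 * t) • v)) (f (x + t • v) + f (x + t • v)),
      norm_add_le (f (x + t • v)) (f (x + t • v)), hc x, hc (x + t • v), hc (x + (2 * t) • v)]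
  by_contra hne
  have hlim : Tendsto (fun t : ℝ => t ^ 2 * ‖w‖) atTop atTop :=
    (tendsto_pow_atTop two_ne_zero).atTop_mul_const (norm_pos_iff.2 hne)
  obtain ⟨t, hlarge, ht⟩ := ((hlim.eventually_gt_atTop (4 * c)).and (eventually_ge_atTop 0)).exists
  exact (hbound t ht).not_gt hlarge

end Taylor

lemma iteratedFDeriv_two_apply_eq_zero_of_norm_gt {E : Type*} [NormedAddCommGroup E]
    [InnerProductSpace ℝ E] [NormedSpace ℝ G] [CompleteSpace G] {f : E → G} (hf : ContDiff ℝ 3 f)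
    {c M : ℝ} (hc : ∀ x, ‖f x‖ ≤ c) (hM : ∀ x, M < ‖x‖ → iteratedFDeriv ℝ 3 f x = 0)
    {x : E} (hx : M < ‖x‖) (v : E) : (iteratedFDeriv ℝ 2 f x fun _ => v) = 0 := by
  have houtward : ∀ w : E, 0 ≤ inner ℝ x w → (iteratedFDeriv ℝ 2 f x fun _ => w) = 0 := by
    refine fun w hw => iteratedFDeriv_two_eq_zero_of_ray hf hc fun t ht => hM _ (hx.trans_le ?_)
    rw [← sq_le_sq₀ (norm_nonneg _) (norm_nonneg _), norm_add_sq_real, inner_smul_right]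
    nlinarith [mul_nonneg ht hw, sq_nonneg ‖t • w‖]
  rcases le_total 0 (inner ℝ x v) with h | h
  · exact houtward v h
  · have hneg := houtward (-v) (by rw [inner_neg_right]; exact neg_nonneg.2 h)
    rwa [← neg_one_smul ℝ v, iteratedFDeriv_apply_smul, neg_one_sq, one_smul] at hneg

lemma hasDerivAt_iteratedFDeriv_add_smul [NormedSpace ℝ G] {f : E → G} {n : WithTop ℕ∞}
    (hf : ContDiff ℝ n f) {j : ℕ} (hj : j < n) (x v : E) :
    HasDerivAt (fun t : ℝ => iteratedFDeriv ℝ j f (x + t • v) fun _ => v)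
      (iteratedFDeriv ℝ (j + 1) f x fun _ => v) 0 := by
  have hline : HasDerivAt (fun t : ℝ => x + t • v) v 0 := by
    simpa using ((hasDerivAt_id (0 : ℝ)).smul_const v).const_add x
  have hdiff : HasFDerivAt (iteratedFDeriv ℝ j f) (fderiv ℝ (iteratedFDeriv ℝ j f) x)
      (x + (0 : ℝ) • v) := by
    rw [zero_smul, add_zero]
    exact (hf.differentiable_iteratedFDeriv hj x).hasFDerivAt
  exact (ContinuousMultilinearMap.apply ℝ (fun _ : Fin j => E) G
    fun _ => v).hasFDerivAt.comp_hasDerivAt 0 (hdiff.comp_hasDerivAt 0 hline)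

section HalfNormSq

variable [InnerProductSpace ℝ G] {h : E → G}

lemma contDiff_half_norm_sq {n : WithTop ℕ∞} (hh : ContDiff ℝ n h) :
    ContDiff ℝ n fun x => 1 / 2 * ‖h x‖ ^ 2 :=
  contDiff_const.mul (hh.norm_sq ℝ)

lemma iteratedFDeriv_one_half_norm_sq (hh : ContDiff ℝ 1 h) (x v : E) :
    (iteratedFDeriv ℝ 1 (fun x => 1 / 2 * ‖h x‖ ^ 2) x fun _ => v) =
      inner ℝ (h x) (iteratedFDeriv ℝ 1 h x fun _ => v) := by
  have hchain := (hasDerivAt_iteratedFDeriv_add_smul hh (j := 0)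
    (by norm_num) x v).norm_sq.const_mul (1 / 2 : ℝ)
  have hdef := hasDerivAt_iteratedFDeriv_add_smul (contDiff_half_norm_sq hh) (j := 0)
    (by norm_num) x v
  simp only [iteratedFDeriv_zero_apply] at hchain hdef
  rw [hdef.unique hchain, zero_smul, add_zero]
  ring

lemma iteratedFDeriv_two_half_norm_sq (hh : ContDiff ℝ 2 h) (x v : E) :
    (iteratedFDeriv ℝ 2 (fun x => 1 / 2 * ‖h x‖ ^ 2) x fun _ => v) =
      ‖iteratedFDeriv ℝ 1 h x fun _ => v‖ ^ 2 +
        inner ℝ (h x) (iteratedFDeriv ℝ 2 h x fun _ => v) := by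
  have hchain := (hasDerivAt_iteratedFDeriv_add_smul hh (j := 0) (by norm_num) x v).inner ℝ
    (hasDerivAt_iteratedFDeriv_add_smul hh (j := 1) (by norm_num) x v)
  have hdef := hasDerivAt_iteratedFDeriv_add_smul (contDiff_half_norm_sq hh) (j := 1)
    (by norm_num) x v
  simp only [iteratedFDeriv_zero_apply,
    iteratedFDeriv_one_half_norm_sq (hh.of_le one_le_two)] at hchain hdef
  rw [hdef.unique hchain, zero_smul, add_zero, real_inner_self_eq_norm_sq, add_comm]

lemma iteratedFDeriv_three_half_norm_sq (hh : ContDiff ℝ 3 h) (x v : E) :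
    (iteratedFDeriv ℝ 3 (fun x => 1 / 2 * ‖h x‖ ^ 2) x fun _ => v) =
      3 * inner ℝ (iteratedFDeriv ℝ 1 h x fun _ => v) (iteratedFDeriv ℝ 2 h x fun _ => v) +
        inner ℝ (h x) (iteratedFDeriv ℝ 3 h x fun _ => v) := by
  have hD1 := hasDerivAt_iteratedFDeriv_add_smul hh (j := 1) (by norm_num) x v
  have hchain := hD1.norm_sq.add
    ((hasDerivAt_iteratedFDeriv_add_smul hh (j := 0) (by norm_num) x v).inner ℝ
      (hasDerivAt_iteratedFDeriv_add_smul hh (j := 2) (by norm_num) x v))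
  have hdef := hasDerivAt_iteratedFDeriv_add_smul (contDiff_half_norm_sq hh) (j := 2)
    (by norm_num) x v
  simp only [iteratedFDeriv_zero_apply,
    iteratedFDeriv_two_half_norm_sq (hh.of_le (by norm_num))] at hchain hdef
  rw [hdef.unique hchain]
  simp only [zero_smul, add_zero]
  ring

end HalfNormSq

end DirectionalDerivatives

section AffineMaps

variable {E G : Type*} [NormedAddCommGroup E] [NormedSpace ℝ E] [NormedAddCommGroup G]
  [NormedSpace ℝ G]

lemma fderiv_clm_sub_const (L : E →L[ℝ] G) (a : G) : fderiv ℝ (fun x => L x - a) = fun _ => L := by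
  ext1 x
  rw [fderiv_sub_const, L.fderiv]

lemma iteratedFDeriv_one_clm_sub_const (L : E →L[ℝ] G) (a : G) (x v : E) :
    (iteratedFDeriv ℝ 1 (fun x => L x - a) x fun _ => v) = L v := by
  rw [iteratedFDeriv_one_apply, fderiv_clm_sub_const]

lemma iteratedFDeriv_add_two_clm_sub_const (L : E →L[ℝ] G) (a : G) (n : ℕ) (x : E) :
    iteratedFDeriv ℝ (n + 2) (fun x => L x - a) x = 0 := by
  rw [← norm_eq_zero, ← norm_iteratedFDeriv_fderiv, fderiv_clm_sub_const, norm_eq_zero,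
    iteratedFDeriv_succ_const]
  rfl

end AffineMaps

section DiffNorm

variable {d j : ℕ} {S : Matrix (Fin d) (Fin d) ℝ} {F : Vec d → Vec d}

lemma diffNorm_nonneg (S : Matrix (Fin d) (Fin d) ℝ) (j : ℕ) (F : Vec d → Vec d) (x : Vec d) :
    0 ≤ diffNorm S j F x :=
  Real.sSup_nonneg fun _ ⟨_, _, hr⟩ => hr ▸ norm_nonneg _

lemma norm_le_norm_sqrtEquiv_mul_wnorm (hS : S.PosDef) (v : Vec d) :
    ‖v‖ ≤ ‖(sqrtEquiv hS : Vec d →L[ℝ] Vec d)‖ * wnorm S v := by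
  obtain ⟨z, rfl⟩ := (sqrtEquiv hS).surjective v
  rw [wnorm_sqrtEquiv hS]
  exact (sqrtEquiv hS : Vec d →L[ℝ] Vec d).le_opNorm z

lemma norm_iteratedFDeriv_le_diffNorm (hS : S.PosDef) (x : Vec d) {h : Fin j → Vec d}
    (hh : ∀ i, wnorm S (h i) ≤ 1) : ‖iteratedFDeriv ℝ j F x h‖ ≤ diffNorm S j F x := by
  refine le_csSup ⟨‖iteratedFDeriv ℝ j F x‖ * ∏ _i : Fin j,
    ‖(sqrtEquiv hS : Vec d →L[ℝ] Vec d)‖, ?_⟩ ⟨h, hh, rfl⟩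
  rintro _ ⟨g, hg, rfl⟩
  refine (ContinuousMultilinearMap.le_opNorm _ g).trans ?_
  gcongr with i
  exact (norm_le_norm_sqrtEquiv_mul_wnorm hS (g i)).trans
    (mul_le_of_le_one_right (norm_nonneg _) (hg i))

lemma wnorm_smul (hS : S.PosDef) (c : ℝ) (v : Vec d) : wnorm S (c • v) = |c| * wnorm S v := by
  rw [wnorm_eq_norm_symm hS, wnorm_eq_norm_symm hS, map_smul, norm_smul, Real.norm_eq_abs]

lemma wnorm_smul_inv_wnorm_smul (hS : S.PosDef) (v : Vec d) :
    wnorm S v • (wnorm S v)⁻¹ • v = v := by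
  rcases eq_or_ne (wnorm S v) 0 with hv | hv
  · rw [hv, zero_smul]
    rw [wnorm_eq_norm_symm hS, norm_eq_zero, EmbeddingLike.map_eq_zero_iff] at hv
    exact hv.symm
  · exact smul_inv_smul₀ hv v

lemma norm_iteratedFDeriv_apply_le (hS : S.PosDef) {x : Vec d} {c : ℝ}
    (hc : diffNorm S j F x ≤ c) (v : Vec d) :
    ‖iteratedFDeriv ℝ j F x fun _ => v‖ ≤ c * wnorm S v ^ j := by
  have hunit : wnorm S ((wnorm S v)⁻¹ • v) ≤ 1 := by
    rw [wnorm_smul hS, abs_of_nonneg (inv_nonneg.2 (wnorm_nonneg S v))]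
    exact inv_mul_le_one
  rw [← congrArg (fun u => iteratedFDeriv ℝ j F x fun _ => u) (wnorm_smul_inv_wnorm_smul hS v),
    iteratedFDeriv_apply_smul, norm_smul, norm_pow, Real.norm_of_nonneg (wnorm_nonneg S v),
    mul_comm]
  exact mul_le_mul_of_nonneg_right
    ((norm_iteratedFDeriv_le_diffNorm hS x fun _ => hunit).trans hc)
    (pow_nonneg (wnorm_nonneg S v) j)

end DiffNorm

section QuadraticRemainder

variable {d : ℕ} {f : Vec d → ℝ} {xhat : Vec d}

lemma dotProduct_hessian_mulVec (f : Vec d → ℝ) (x v : Vec d) :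
    v.ofLp ⬝ᵥ (hessian f x *ᵥ v.ofLp) = iteratedFDeriv ℝ 2 f x fun _ => v := by
  have hv : v = ∑ j, v j • EuclideanSpace.single j (1 : ℝ) := by
    simpa using ((EuclideanSpace.basisFun (Fin d) ℝ).sum_repr v).symm
  have hentry : ∀ a b : Vec d, iteratedFDeriv ℝ 2 f x ![a, b] = fderiv ℝ (fderiv ℝ f) x a b :=
    fun a b => iteratedFDeriv_two_apply f x ![a, b]
  rw [iteratedFDeriv_two_apply]
  conv_rhs => rw [hv]
  simp only [map_sum, map_smul, _root_.sum_apply, _root_.smul_apply, smul_eq_mul, dotProduct,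
    Matrix.mulVec, hessian, Matrix.of_apply, hentry, Finset.mul_sum]
  rw [Finset.sum_comm]
  exact Finset.sum_congr rfl fun i _ => Finset.sum_congr rfl fun j _ => by ring

lemma wnorm_inv_hessian_sq (h : (hessian f xhat).PosDef) (v : Vec d) :
    wnorm (hessian f xhat)⁻¹ v ^ 2 = iteratedFDeriv ℝ 2 f xhat fun _ => v := by
  rw [wnorm, Matrix.nonsing_inv_nonsing_inv _ h.det_pos.ne'.isUnit, dotProduct_hessian_mulVec,
    Real.sq_sqrt]
  simpa [dotProduct_hessian_mulVec] using h.posSemidef.dotProduct_mulVec_nonneg v.ofLp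

lemma abs_quadraticRemainder_le_cube (hf : ContDiff ℝ 3 f) (hzero : f xhat = 0)
    (hcrit : fderiv ℝ f xhat = 0) (hpos : (hessian f xhat).PosDef) {c : ℝ}
    (hc : ∀ x v, |iteratedFDeriv ℝ 3 f x fun _ => v| ≤ c * wnorm (hessian f xhat)⁻¹ v ^ 3)
    (x : Vec d) :
    |quadraticRemainder f xhat x| ≤ c / 6 * wnorm (hessian f xhat)⁻¹ (x - xhat) ^ 3 := by
  have htaylor := norm_sub_taylor_sum_le (f := f) 2 (by exact_mod_cast hf) xhat (x - xhat) 0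
    fun t _ => by rw [sub_zero]; exact hc (xhat + t • (x - xhat)) (x - xhat)
  rw [add_sub_cancel] at htaylor
  simpa [Finset.sum_range_succ, hzero, hcrit, ← wnorm_inv_hessian_sq hpos, quadraticRemainder,
    Nat.factorial, mul_div_right_comm] using htaylor

lemma abs_quadraticRemainder_le_sq (hf : ContDiff ℝ 2 f) (hzero : f xhat = 0)
    (hcrit : fderiv ℝ f xhat = 0) (hpos : (hessian f xhat).PosDef) {c : ℝ}
    (hc : ∀ x v, |(iteratedFDeriv ℝ 2 f x fun _ => v) - iteratedFDeriv ℝ 2 f xhat fun _ => v| ≤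
      c * wnorm (hessian f xhat)⁻¹ v ^ 2) (x : Vec d) :
    |quadraticRemainder f xhat x| ≤ c / 2 * wnorm (hessian f xhat)⁻¹ (x - xhat) ^ 2 := by
  have htaylor := norm_sub_taylor_sum_le (f := f) 1 (by exact_mod_cast hf) xhat (x - xhat) _
    fun t _ => hc (xhat + t • (x - xhat)) (x - xhat)
  rw [add_sub_cancel] at htaylor
  simpa [Finset.sum_range_succ, hzero, hcrit, ← wnorm_inv_hessian_sq hpos, quadraticRemainder,
    Nat.factorial, mul_div_right_comm] using htaylor

end QuadraticRemainder

section PerturbedMap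

variable {d : ℕ} {A : Matrix (Fin d) (Fin d) ℝ} {F : Vec d → Vec d}

lemma perturbedMap_sub_eq (A : Matrix (Fin d) (Fin d) ℝ) (F : Vec d → Vec d) (τ : ℝ) (y : Vec d) :
    (fun x => perturbedMap A F τ x - y) =
      (fun x => Matrix.toEuclideanCLM (𝕜 := ℝ) A x - y) + τ • F := by
  ext1 x
  exact add_sub_right_comm _ _ _

lemma contDiff_perturbedMap_sub {n : WithTop ℕ∞} (hF : ContDiff ℝ n F) (τ : ℝ) (y : Vec d) :
    ContDiff ℝ n fun x => perturbedMap A F τ x - y := by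
  rw [perturbedMap_sub_eq]
  exact ((ContinuousLinearMap.contDiff _).sub contDiff_const).add (contDiff_const.smul hF)

lemma iteratedFDeriv_perturbedMap_sub {n : ℕ} (hF : ContDiff ℝ n F) (τ : ℝ) (x y : Vec d) :
    iteratedFDeriv ℝ n (fun x => perturbedMap A F τ x - y) x =
      iteratedFDeriv ℝ n (fun x => Matrix.toEuclideanCLM (𝕜 := ℝ) A x - y) x +
        τ • iteratedFDeriv ℝ n F x := by
  have hτF : ContDiff ℝ n (τ • F) := contDiff_const.smul hF
  rw [perturbedMap_sub_eq, iteratedFDeriv_add_apply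
    ((ContinuousLinearMap.contDiff _).sub contDiff_const).contDiffAt hτF.contDiffAt,
    iteratedFDeriv_const_smul_apply hF.contDiffAt]

lemma iteratedFDeriv_one_perturbedMap_sub (hF : ContDiff ℝ 1 F) (τ : ℝ) (x y v : Vec d) :
    (iteratedFDeriv ℝ 1 (fun x => perturbedMap A F τ x - y) x fun _ => v) =
      Matrix.toEuclideanLin A v + τ • iteratedFDeriv ℝ 1 F x fun _ => v := by
  rw [iteratedFDeriv_perturbedMap_sub (by exact_mod_cast hF),
    _root_.add_apply, iteratedFDeriv_one_clm_sub_const]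
  rfl

lemma iteratedFDeriv_add_two_perturbedMap_sub {n : ℕ} (hF : ContDiff ℝ (n + 2 : ℕ) F) (τ : ℝ)
    (x y v : Vec d) :
    (iteratedFDeriv ℝ (n + 2) (fun x => perturbedMap A F τ x - y) x fun _ => v) =
      τ • iteratedFDeriv ℝ (n + 2) F x fun _ => v := by
  rw [iteratedFDeriv_perturbedMap_sub hF, iteratedFDeriv_add_two_clm_sub_const, zero_add]
  rfl

end PerturbedMap

section HalfWnormSq

variable {d : ℕ} {S : Matrix (Fin d) (Fin d) ℝ}

lemma half_wnorm_sq_eq (hS : S.PosDef) (m : Vec d) :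
    (fun x => 1 / 2 * wnorm S (x - m) ^ 2) = fun x =>
      1 / 2 * ‖((sqrtEquiv hS).symm : Vec d →L[ℝ] Vec d) x - (sqrtEquiv hS).symm m‖ ^ 2 := by
  ext1 x
  rw [wnorm_eq_norm_symm hS, map_sub, ContinuousLinearEquiv.coe_coe]

lemma contDiff_half_wnorm_sq (hS : S.PosDef) (m : Vec d) (n : WithTop ℕ∞) :
    ContDiff ℝ n fun x => 1 / 2 * wnorm S (x - m) ^ 2 := by
  rw [half_wnorm_sq_eq hS]
  exact contDiff_half_norm_sq ((ContinuousLinearMap.contDiff _).sub contDiff_const)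

lemma iteratedFDeriv_two_half_wnorm_sq (hS : S.PosDef) (m x v : Vec d) :
    (iteratedFDeriv ℝ 2 (fun x => 1 / 2 * wnorm S (x - m) ^ 2) x fun _ => v) = wnorm S v ^ 2 := by
  rw [half_wnorm_sq_eq hS,
    iteratedFDeriv_two_half_norm_sq ((ContinuousLinearMap.contDiff _).sub contDiff_const),
    iteratedFDeriv_one_clm_sub_const, iteratedFDeriv_add_two_clm_sub_const, _root_.zero_apply,
    inner_zero_right, add_zero, wnorm_eq_norm_symm hS, ContinuousLinearEquiv.coe_coe]

lemma iteratedFDeriv_three_half_wnorm_sq (hS : S.PosDef) (m x v : Vec d) :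
    (iteratedFDeriv ℝ 3 (fun x => 1 / 2 * wnorm S (x - m) ^ 2) x fun _ => v) = 0 := by
  rw [half_wnorm_sq_eq hS,
    iteratedFDeriv_three_half_norm_sq ((ContinuousLinearMap.contDiff _).sub contDiff_const),
    iteratedFDeriv_add_two_clm_sub_const, iteratedFDeriv_add_two_clm_sub_const, _root_.zero_apply,
    _root_.zero_apply, inner_zero_right, inner_zero_right, mul_zero, add_zero]

end HalfWnormSq

section PerturbedPotential

variable {d : ℕ} {S₀ : Matrix (Fin d) (Fin d) ℝ} {F : Vec d → Vec d}

lemma perturbedPotential_self (ε : ℝ) (A : Matrix (Fin d) (Fin d) ℝ) (F : Vec d → Vec d)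
    (m₀ : Vec d) (S₀ : Matrix (Fin d) (Fin d) ℝ) (τ : ℝ) (y xhat : Vec d) :
    perturbedPotential ε A F m₀ S₀ τ y xhat xhat = 0 := by
  rw [perturbedPotential, potential]
  ring

lemma exists_perturbedPotential_eq (ε : ℝ) (A : Matrix (Fin d) (Fin d) ℝ) (F : Vec d → Vec d)
    (m₀ : Vec d) (S₀ : Matrix (Fin d) (Fin d) ℝ) (τ : ℝ) (y xhat : Vec d) :
    ∃ c, perturbedPotential ε A F m₀ S₀ τ y xhat =
      (fun x => 1 / 2 * ‖perturbedMap A F τ x - y‖ ^ 2) +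
        (ε • fun x => 1 / 2 * wnorm S₀ (x - m₀) ^ 2) + fun _ => c := by
  refine ⟨ε * (d / 2 * Real.log (2 * Real.pi) + 1 / 2 * Real.log S₀.det) -
    misfit (perturbedMap A F τ) y xhat - ε * gaussianNegLogDensity m₀ S₀ xhat, ?_⟩
  ext x
  simp only [perturbedPotential, potential, Pi.add_apply, Pi.smul_apply, smul_eq_mul]
  rw [misfit, norm_sub_rev y, gaussianNegLogDensity]
  ring

lemma contDiff_perturbedPotential (ε : ℝ) (A : Matrix (Fin d) (Fin d) ℝ) {n : WithTop ℕ∞}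
    (hF : ContDiff ℝ n F) (m₀ : Vec d) (hS₀ : S₀.PosDef) (τ : ℝ) (y xhat : Vec d) :
    ContDiff ℝ n (perturbedPotential ε A F m₀ S₀ τ y xhat) := by
  obtain ⟨c, hc⟩ := exists_perturbedPotential_eq ε A F m₀ S₀ τ y xhat
  rw [hc]
  exact ((contDiff_half_norm_sq (contDiff_perturbedMap_sub hF τ y)).add
    (contDiff_const.smul (contDiff_half_wnorm_sq hS₀ m₀ n))).add contDiff_const

lemma iteratedFDeriv_succ_perturbedPotential (ε : ℝ) (A : Matrix (Fin d) (Fin d) ℝ) {n : ℕ}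
    (hF : ContDiff ℝ (n + 1 : ℕ) F) (m₀ : Vec d) (hS₀ : S₀.PosDef) (τ : ℝ) (y xhat x : Vec d) :
    iteratedFDeriv ℝ (n + 1) (perturbedPotential ε A F m₀ S₀ τ y xhat) x =
      iteratedFDeriv ℝ (n + 1) (fun x => 1 / 2 * ‖perturbedMap A F τ x - y‖ ^ 2) x +
        ε • iteratedFDeriv ℝ (n + 1) (fun x => 1 / 2 * wnorm S₀ (x - m₀) ^ 2) x := by
  obtain ⟨c, hc⟩ := exists_perturbedPotential_eq ε A F m₀ S₀ τ y xhat
  have hmisfit := contDiff_half_norm_sq (contDiff_perturbedMap_sub (A := A) hF τ y)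
  have hprior := contDiff_half_wnorm_sq hS₀ m₀ (n + 1 : ℕ)
  have hscaled : ContDiff ℝ (n + 1 : ℕ) (ε • fun x => 1 / 2 * wnorm S₀ (x - m₀) ^ 2) :=
    contDiff_const.smul hprior
  have hsum := hmisfit.add hscaled
  rw [hc, iteratedFDeriv_add_apply (f := _ + _) hsum.contDiffAt contDiff_const.contDiffAt,
    iteratedFDeriv_add_apply hmisfit.contDiffAt hscaled.contDiffAt,
    iteratedFDeriv_const_smul_apply hprior.contDiffAt, iteratedFDeriv_succ_const]
  exact add_zero _

lemma iteratedFDeriv_two_perturbedPotential (ε : ℝ) (A : Matrix (Fin d) (Fin d) ℝ)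
    (hF : ContDiff ℝ 2 F) (m₀ : Vec d) (hS₀ : S₀.PosDef) (τ : ℝ) (y xhat x v : Vec d) :
    (iteratedFDeriv ℝ 2 (perturbedPotential ε A F m₀ S₀ τ y xhat) x fun _ => v) =
      ‖Matrix.toEuclideanLin A v + τ • iteratedFDeriv ℝ 1 F x fun _ => v‖ ^ 2 +
        inner ℝ (perturbedMap A F τ x - y) (τ • iteratedFDeriv ℝ 2 F x fun _ => v) +
          ε * wnorm S₀ v ^ 2 := by
  rw [iteratedFDeriv_succ_perturbedPotential ε A hF m₀ hS₀, _root_.add_apply, _root_.smul_apply,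
    iteratedFDeriv_two_half_norm_sq (contDiff_perturbedMap_sub hF τ y),
    iteratedFDeriv_two_half_wnorm_sq hS₀, smul_eq_mul,
    iteratedFDeriv_one_perturbedMap_sub (hF.of_le one_le_two),
    iteratedFDeriv_add_two_perturbedMap_sub hF]

lemma iteratedFDeriv_three_perturbedPotential (ε : ℝ) (A : Matrix (Fin d) (Fin d) ℝ)
    (hF : ContDiff ℝ 3 F) (m₀ : Vec d) (hS₀ : S₀.PosDef) (τ : ℝ) (y xhat x v : Vec d) :
    (iteratedFDeriv ℝ 3 (perturbedPotential ε A F m₀ S₀ τ y xhat) x fun _ => v) =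
      3 * inner ℝ (Matrix.toEuclideanLin A v + τ • iteratedFDeriv ℝ 1 F x fun _ => v)
          (τ • iteratedFDeriv ℝ 2 F x fun _ => v) +
        inner ℝ (perturbedMap A F τ x - y) (τ • iteratedFDeriv ℝ 3 F x fun _ => v) := by
  have hF₂ : ContDiff ℝ 2 F := hF.of_le (by norm_num)
  rw [iteratedFDeriv_succ_perturbedPotential ε A hF m₀ hS₀, _root_.add_apply, _root_.smul_apply,
    iteratedFDeriv_three_half_norm_sq (contDiff_perturbedMap_sub hF τ y),
    iteratedFDeriv_three_half_wnorm_sq hS₀, smul_zero, add_zero,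
    iteratedFDeriv_one_perturbedMap_sub (hF.of_le (by norm_num)),
    iteratedFDeriv_add_two_perturbedMap_sub hF₂, iteratedFDeriv_add_two_perturbedMap_sub hF]

end PerturbedPotential

section Bounds

variable {d : ℕ} {S : Matrix (Fin d) (Fin d) ℝ} {F : Vec d → Vec d} {C₀ C₁ C₂ C₃ M τ : ℝ}

lemma opNorm_nonneg (A : Matrix (Fin d) (Fin d) ℝ) : 0 ≤ opNorm A := norm_nonneg _

lemma norm_smul_le_mul_of_nonneg {E : Type*} [SeminormedAddCommGroup E] [NormedSpace ℝ E]
    {w : E} {c : ℝ} (hτ : 0 ≤ τ) (hw : ‖w‖ ≤ c) : ‖τ • w‖ ≤ τ * c := by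
  rw [norm_smul, Real.norm_of_nonneg hτ]
  exact mul_le_mul_of_nonneg_left hw hτ

lemma norm_le_of_diffNorm_zero_le (hS : S.PosDef) {x : Vec d} (h : diffNorm S 0 F x ≤ C₀) :
    ‖F x‖ ≤ C₀ := by
  simpa using norm_iteratedFDeriv_apply_le hS h 0

lemma norm_perturbedMap_sub_le (A : Matrix (Fin d) (Fin d) ℝ) (hτ : 0 ≤ τ)
    {x : Vec d} (hF₀ : ‖F x‖ ≤ C₀) (hx : ‖x‖ ≤ M) (y : Vec d) :
    ‖perturbedMap A F τ x - y‖ ≤ opNorm A * M + ‖y‖ + τ * C₀ := by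
  have hA : ‖Matrix.toEuclideanLin A x‖ ≤ opNorm A * M :=
    ((Matrix.toEuclideanCLM (𝕜 := ℝ) A).le_opNorm x).trans
      (mul_le_mul_of_nonneg_left hx (opNorm_nonneg A))
  have hF := norm_smul_le_mul_of_nonneg hτ hF₀
  rw [perturbedMap]
  linarith [norm_sub_le (Matrix.toEuclideanLin A x + τ • F x) y,
    norm_add_le (Matrix.toEuclideanLin A x) (τ • F x)]

lemma norm_linearized_perturbedMap_le (A : Matrix (Fin d) (Fin d) ℝ) (hS : S.PosDef) (hτ : 0 ≤ τ)
    {x : Vec d} (hF₁ : diffNorm S 1 F x ≤ C₁) (v : Vec d) :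
    ‖Matrix.toEuclideanLin A v + τ • iteratedFDeriv ℝ 1 F x fun _ => v‖ ≤
      (opNorm (A * matSqrt S) + τ * C₁) * wnorm S v := by
  have hF := norm_smul_le_mul_of_nonneg hτ (norm_iteratedFDeriv_apply_le hS hF₁ v)
  rw [pow_one] at hF
  linarith [norm_add_le (Matrix.toEuclideanLin A v) (τ • iteratedFDeriv ℝ 1 F x fun _ => v),
    norm_toEuclideanLin_le_opNorm_mul_matSqrt A hS v]

lemma abs_inner_perturbedMap_sub_le (A : Matrix (Fin d) (Fin d) ℝ) (hS : S.PosDef) (hτ : 0 ≤ τ)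
    (hM : 0 ≤ M) {j : ℕ} {c : ℝ} {x : Vec d} (hF₀ : diffNorm S 0 F x ≤ C₀)
    (hFj : diffNorm S j F x ≤ c) (y v : Vec d)
    (hsupp : M < ‖x‖ → (iteratedFDeriv ℝ j F x fun _ => v) = 0) :
    |inner ℝ (perturbedMap A F τ x - y) (τ • iteratedFDeriv ℝ j F x fun _ => v)| ≤
      (opNorm A * M + ‖y‖ + τ * C₀) * (τ * c) * wnorm S v ^ j := by
  have hA := opNorm_nonneg A
  have hC₀ := (diffNorm_nonneg S 0 F x).trans hF₀
  have hc := (diffNorm_nonneg S j F x).trans hFj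
  have hv := wnorm_nonneg S v
  rcases le_or_gt ‖x‖ M with hx | hx
  · refine (abs_real_inner_le_norm _ _).trans ?_
    rw [norm_smul, Real.norm_of_nonneg hτ, mul_assoc, mul_assoc τ]
    gcongr
    · exact norm_perturbedMap_sub_le A hτ (norm_le_of_diffNorm_zero_le hS hF₀) hx y
    · exact norm_iteratedFDeriv_apply_le hS hFj v
  · rw [hsupp hx, smul_zero, inner_zero_right, abs_zero]
    positivity

end Bounds

section PotentialBounds

variable {d : ℕ} {S S₀ : Matrix (Fin d) (Fin d) ℝ} {F : Vec d → Vec d} {C₀ C₁ C₂ C₃ M τ : ℝ}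

lemma abs_iteratedFDeriv_three_perturbedPotential_le (ε : ℝ) (A : Matrix (Fin d) (Fin d) ℝ)
    (hF : ContDiff ℝ 3 F) (m₀ : Vec d) (hS₀ : S₀.PosDef) (hτ : 0 ≤ τ) (y xhat : Vec d)
    (hS : S.PosDef) (hM : 0 ≤ M)
    (hF₀ : ∀ x, diffNorm S 0 F x ≤ C₀) (hF₁ : ∀ x, diffNorm S 1 F x ≤ C₁)
    (hF₂ : ∀ x, diffNorm S 2 F x ≤ C₂) (hF₃ : ∀ x, diffNorm S 3 F x ≤ C₃)
    (hFM : ∀ x, M < ‖x‖ → iteratedFDeriv ℝ 3 F x = 0) (x v : Vec d) :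
    |iteratedFDeriv ℝ 3 (perturbedPotential ε A F m₀ S₀ τ y xhat) x fun _ => v| ≤
      (constV C₂ C₃ M A S y * τ + constW C₀ C₁ C₂ C₃ * τ ^ 2) * wnorm S v ^ 3 := by
  set s := wnorm S v
  set a := Matrix.toEuclideanLin A v + τ • iteratedFDeriv ℝ 1 F x fun _ => v
  set b := τ • iteratedFDeriv ℝ 2 F x fun _ => v
  have ha : ‖a‖ ≤ (opNorm (A * matSqrt S) + τ * C₁) * s :=
    norm_linearized_perturbedMap_le A hS hτ (hF₁ x) v
  have hb : ‖b‖ ≤ τ * (C₂ * s ^ 2) :=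
    norm_smul_le_mul_of_nonneg hτ (norm_iteratedFDeriv_apply_le hS (hF₂ x) v)
  have hab : |inner ℝ a b| ≤ (opNorm (A * matSqrt S) + τ * C₁) * s * (τ * (C₂ * s ^ 2)) :=
    (abs_real_inner_le_norm _ _).trans
      (mul_le_mul ha hb (norm_nonneg _) ((norm_nonneg _).trans ha))
  have hres := abs_inner_perturbedMap_sub_le A hS hτ hM (hF₀ x) (hF₃ x) y v fun hx => by
    rw [hFM x hx, _root_.zero_apply]
  rw [iteratedFDeriv_three_perturbedPotential ε A hF m₀ hS₀]
  refine (abs_add_le _ _).trans ?_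
  rw [abs_mul, abs_of_pos (three_pos : (0 : ℝ) < 3)]
  refine (add_le_add (mul_le_mul_of_nonneg_left hab zero_le_three) hres).trans_eq ?_
  rw [constV, constW]
  ring

/-- `Q_τ = 2 C₁ (‖A S^{1/2}‖ + τ C₁) + C₂ (‖A‖ M + |y| + τ C₀)`. The oscillation of `D²I_τ` in
the norm `‖·‖_S` is at most `2 τ Q_τ`. -/
def constQ {d : ℕ} (C₀ C₁ C₂ M τ : ℝ) (A S : Matrix (Fin d) (Fin d) ℝ) (y : Vec d) : ℝ :=
  2 * C₁ * (opNorm (A * matSqrt S) + τ * C₁) + C₂ * (opNorm A * M + ‖y‖ + τ * C₀)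

lemma abs_norm_sq_sub_norm_sq_le {E : Type*} [NormedAddCommGroup E] [InnerProductSpace ℝ E]
    (a b : E) : |‖a‖ ^ 2 - ‖b‖ ^ 2| ≤ (‖a‖ + ‖b‖) * ‖a - b‖ := by
  rw [sq_sub_sq, abs_mul, abs_of_nonneg (by positivity)]
  exact mul_le_mul_of_nonneg_left (abs_norm_sub_norm_le a b) (by positivity)

lemma abs_iteratedFDeriv_two_perturbedPotential_sub_le (ε : ℝ) (A : Matrix (Fin d) (Fin d) ℝ)
    (hF : ContDiff ℝ 3 F) (m₀ : Vec d) (hS₀ : S₀.PosDef) (hτ : 0 ≤ τ) (y xhat : Vec d)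
    (hS : S.PosDef) (hM : 0 ≤ M)
    (hF₀ : ∀ x, diffNorm S 0 F x ≤ C₀) (hF₁ : ∀ x, diffNorm S 1 F x ≤ C₁)
    (hF₂ : ∀ x, diffNorm S 2 F x ≤ C₂)
    (hFM : ∀ x, M < ‖x‖ → iteratedFDeriv ℝ 3 F x = 0) (x z v : Vec d) :
    |(iteratedFDeriv ℝ 2 (perturbedPotential ε A F m₀ S₀ τ y xhat) x fun _ => v) -
        iteratedFDeriv ℝ 2 (perturbedPotential ε A F m₀ S₀ τ y xhat) z fun _ => v| ≤
      2 * (τ * constQ C₀ C₁ C₂ M τ A S y) * wnorm S v ^ 2 := by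
  set s := wnorm S v
  have hsupp : ∀ x, M < ‖x‖ → (iteratedFDeriv ℝ 2 F x fun _ => v) = 0 := fun x hx =>
    iteratedFDeriv_two_apply_eq_zero_of_norm_gt hF
      (fun x => norm_le_of_diffNorm_zero_le hS (hF₀ x)) hFM hx v
  have hinner := fun x => abs_inner_perturbedMap_sub_le A hS hτ hM (hF₀ x) (hF₂ x) y v (hsupp x)
  set a := fun x => Matrix.toEuclideanLin A v + τ • iteratedFDeriv ℝ 1 F x fun _ => v with ha
  have hnorm : ∀ x, ‖a x‖ ≤ (opNorm (A * matSqrt S) + τ * C₁) * s := fun x =>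
    norm_linearized_perturbedMap_le A hS hτ (hF₁ x) v
  have hdiff : ‖a x - a z‖ ≤ τ * (2 * C₁ * s) := by
    rw [ha, add_sub_add_left_eq_sub, ← smul_sub]
    refine norm_smul_le_mul_of_nonneg hτ ((norm_sub_le _ _).trans ?_)
    linarith [norm_iteratedFDeriv_apply_le hS (hF₁ x) v, norm_iteratedFDeriv_apply_le hS (hF₁ z) v,
      pow_one (wnorm S v)]
  have hsq : |‖a x‖ ^ 2 - ‖a z‖ ^ 2| ≤
      2 * ((opNorm (A * matSqrt S) + τ * C₁) * s) * (τ * (2 * C₁ * s)) := by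
    refine (abs_norm_sq_sub_norm_sq_le _ _).trans
      (mul_le_mul (by linarith [hnorm x, hnorm z]) hdiff (norm_nonneg _) ?_)
    linarith [norm_nonneg (a x), hnorm x]
  rw [iteratedFDeriv_two_perturbedPotential ε A (hF.of_le (by norm_num)) m₀ hS₀,
    iteratedFDeriv_two_perturbedPotential ε A (hF.of_le (by norm_num)) m₀ hS₀,
    add_sub_add_right_eq_sub, add_sub_add_comm]
  refine (abs_add_le _ _).trans ((add_le_add hsq ((abs_sub _ _).trans
    (add_le_add (hinner x) (hinner z)))).trans_eq ?_)
  rw [constQ]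
  ring

lemma opNorm_mul_matSqrt_inv_hessian_le {ε : ℝ} (hε : 0 ≤ ε) (A : Matrix (Fin d) (Fin d) ℝ)
    (hF : ContDiff ℝ 3 F) (m₀ : Vec d) (hS₀ : S₀.PosDef) (hτ : 0 ≤ τ) (y xhat : Vec d)
    (hpos : (hessian (perturbedPotential ε A F m₀ S₀ τ y xhat) xhat).PosDef)
    (hS : S = (hessian (perturbedPotential ε A F m₀ S₀ τ y xhat) xhat)⁻¹) (hM : 0 ≤ M)
    (hF₀ : ∀ x, diffNorm S 0 F x ≤ C₀) (hF₁ : ∀ x, diffNorm S 1 F x ≤ C₁)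
    (hF₂ : ∀ x, diffNorm S 2 F x ≤ C₂)
    (hFM : ∀ x, M < ‖x‖ → iteratedFDeriv ℝ 3 F x = 0) :
    opNorm (A * matSqrt S) ≤ 1 + τ * (C₁ + C₂ * (opNorm A * M + ‖y‖ + τ * C₀)) := by
  have hSpos : S.PosDef := hS ▸ hpos.inv
  have hA := opNorm_nonneg A
  have hC₀ := (diffNorm_nonneg S 0 F xhat).trans (hF₀ xhat)
  have hC₁ := (diffNorm_nonneg S 1 F xhat).trans (hF₁ xhat)
  have hC₂ := (diffNorm_nonneg S 2 F xhat).trans (hF₂ xhat)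
  refine opNorm_mul_matSqrt_le hSpos (by positivity) fun v => ?_
  have hs := wnorm_nonneg S v
  set q := τ * (C₂ * (opNorm A * M + ‖y‖ + τ * C₀)) with hq
  have : 0 ≤ q := by positivity
  set b := τ • iteratedFDeriv ℝ 1 F xhat fun _ => v
  have hb : ‖b‖ ≤ τ * (C₁ * wnorm S v ^ 1) := norm_smul_le_mul_of_nonneg hτ
    (norm_iteratedFDeriv_apply_le hSpos (hF₁ xhat) v)
  have hinner := abs_inner_perturbedMap_sub_le A hSpos hτ hM (hF₀ xhat) (hF₂ xhat) y v fun hx =>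
    iteratedFDeriv_two_apply_eq_zero_of_norm_gt hF
      (fun x => norm_le_of_diffNorm_zero_le hSpos (hF₀ x)) hFM hx v
  have hlin : ‖Matrix.toEuclideanLin A v + b‖ ^ 2 ≤ ((1 + q) * wnorm S v) ^ 2 := by
    have hsq := wnorm_inv_hessian_sq hpos v
    rw [← hS, iteratedFDeriv_two_perturbedPotential ε A (hF.of_le (by norm_num)) m₀ hS₀] at hsq
    have hprior : 0 ≤ ε * wnorm S₀ v ^ 2 := by positivity
    have hqs : 0 ≤ (q + q ^ 2) * wnorm S v ^ 2 := by positivity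
    linarith [neg_le_of_abs_le hinner]
  have hlin' := (sq_le_sq₀ (norm_nonneg _) (by positivity)).1 hlin
  calc ‖Matrix.toEuclideanLin A v‖
      = ‖Matrix.toEuclideanLin A v + b - b‖ := by rw [add_sub_cancel_right]
    _ ≤ (1 + q) * wnorm S v + τ * (C₁ * wnorm S v ^ 1) :=
        (norm_sub_le _ _).trans (add_le_add hlin' hb)
    _ = (1 + τ * (C₁ + C₂ * (opNorm A * M + ‖y‖ + τ * C₀))) * wnorm S v := by
        rw [hq]
        ring

end PotentialBounds

section FixedPerturbation

variable {d : ℕ} {ε C₀ C₁ C₂ C₃ M τ η : ℝ} {A S S₀ : Matrix (Fin d) (Fin d) ℝ}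
  {F : Vec d → Vec d} {m₀ y xhat : Vec d}

lemma IsUniqueMinimizer.fderiv_eq_zero {f : Vec d → ℝ} {x : Vec d} (hx : IsUniqueMinimizer f x) :
    fderiv ℝ f x = 0 := by
  refine IsLocalMin.fderiv_eq_zero (Eventually.of_forall fun z => ?_)
  rcases eq_or_ne z x with rfl | hz
  · exact le_rfl
  · exact (hx z hz).le

lemma constC_nonneg (d : ℕ) : 0 ≤ constC d := by
  have hnum := Real.Gamma_nonneg_of_nonneg (s := (d : ℝ) / 2 + 3 / 2) (by positivity)
  have hden := Real.Gamma_nonneg_of_nonneg (s := (d : ℝ) / 2) (by positivity)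
  rw [constC]
  exact mul_nonneg (by positivity) (div_nonneg hnum hden)

lemma constV_nonneg (hC₂ : 0 ≤ C₂) (hC₃ : 0 ≤ C₃) (hM : 0 ≤ M)
    (A S : Matrix (Fin d) (Fin d) ℝ) (y : Vec d) : 0 ≤ constV C₂ C₃ M A S y := by
  have hA := opNorm_nonneg A
  have hAS := opNorm_nonneg (A * matSqrt S)
  rw [constV]
  positivity

lemma constW_nonneg (hC₀ : 0 ≤ C₀) (hC₁ : 0 ≤ C₁) (hC₂ : 0 ≤ C₂) (hC₃ : 0 ≤ C₃) :
    0 ≤ constW C₀ C₁ C₂ C₃ := by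
  rw [constW]
  positivity

lemma continuous_misfit_perturbedMap (hF : Continuous F) (τ : ℝ) (y : Vec d) :
    Continuous (misfit (perturbedMap A F τ) y) := by
  have hG := (contDiff_perturbedMap_sub (A := A) (contDiff_zero.2 hF) τ y).continuous
  have hmisfit : misfit (perturbedMap A F τ) y = fun x => 1 / 2 * ‖perturbedMap A F τ x - y‖ ^ 2 :=
    funext fun x => by rw [misfit, norm_sub_rev]
  rw [hmisfit]
  fun_prop

lemma tvDist_perturbedPosterior_laplace_le (hd : 0 < d) (hε : 0 < ε) (hF : ContDiff ℝ 3 F)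
    (hS₀ : S₀.PosDef) (hτ : 0 ≤ τ)
    (hcrit : fderiv ℝ (perturbedPotential ε A F m₀ S₀ τ y xhat) xhat = 0)
    (hpos : (hessian (perturbedPotential ε A F m₀ S₀ τ y xhat) xhat).PosDef)
    (hS : S = (hessian (perturbedPotential ε A F m₀ S₀ τ y xhat) xhat)⁻¹) (hM : 0 ≤ M)
    (hF₀ : ∀ x, diffNorm S 0 F x ≤ C₀) (hF₁ : ∀ x, diffNorm S 1 F x ≤ C₁)
    (hF₂ : ∀ x, diffNorm S 2 F x ≤ C₂) (hF₃ : ∀ x, diffNorm S 3 F x ≤ C₃)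
    (hFM : ∀ x, M < ‖x‖ → iteratedFDeriv ℝ 3 F x = 0)
    (hη : τ * constQ C₀ C₁ C₂ M τ A S y ≤ η) (hη_lt : η < 1 / 2)
    (hη_rpow : (1 - 2 * η) ^ (-((d : ℝ) + 3) / 2) ≤ Real.exp 1) :
    tvDist (perturbedPosterior ε A F m₀ S₀ τ y)
        (laplace ε (perturbedPotential ε A F m₀ S₀ τ y xhat) xhat) ≤
      constC d * (1 + ε) * √ε *
        (constV C₂ C₃ M A S y * τ + constW C₀ C₁ C₂ C₃ / 2 * τ ^ 2) := by
  have hC₀ := (diffNorm_nonneg S 0 F 0).trans (hF₀ 0)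
  have hC₁ := (diffNorm_nonneg S 1 F 0).trans (hF₁ 0)
  have hC₂ := (diffNorm_nonneg S 2 F 0).trans (hF₂ 0)
  have hC₃ := (diffNorm_nonneg S 3 F 0).trans (hF₃ 0)
  have hV := constV_nonneg hC₂ hC₃ hM A S y
  have hW := constW_nonneg hC₀ hC₁ hC₂ hC₃
  subst hS
  have hI : ContDiff ℝ 3 (perturbedPotential ε A F m₀ S₀ τ y xhat) :=
    contDiff_perturbedPotential ε A hF m₀ hS₀ τ y xhat
  have hI_zero := perturbedPotential_self ε A F m₀ S₀ τ y xhat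
  have hthird := abs_iteratedFDeriv_three_perturbedPotential_le ε A hF m₀ hS₀ hτ y xhat hpos.inv
    hM hF₀ hF₁ hF₂ hF₃ hFM
  have hsecond := fun x v => abs_iteratedFDeriv_two_perturbedPotential_sub_le ε A hF m₀ hS₀ hτ y
    xhat hpos.inv hM hF₀ hF₁ hF₂ hFM x xhat v
  have hcube := abs_quadraticRemainder_le_cube hI hI_zero hcrit hpos hthird
  have hsq := fun x => (abs_quadraticRemainder_le_sq (hI.of_le (by norm_num)) hI_zero hcrit hpos
    hsecond x).trans (mul_le_mul_of_nonneg_right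
      ((mul_div_cancel_left₀ _ two_ne_zero).trans_le hη) (sq_nonneg _))
  have hC := constC_nonneg d
  set V := constV C₂ C₃ M A (hessian (perturbedPotential ε A F m₀ S₀ τ y xhat) xhat)⁻¹ y
  set W := constW C₀ C₁ C₂ C₃
  have hVτ : 0 ≤ V * τ := mul_nonneg hV hτ
  calc _ ≤ constC d * √ε * (3 * ((V * τ + W * τ ^ 2) / 6)) :=
        tvDist_posterior_laplace_le hd hε (continuous_misfit_perturbedMap hF.continuous τ y) hS₀
          hpos (by positivity) hη_lt hη_rpow hcube hsq
    _ ≤ constC d * √ε * (V * τ + W / 2 * τ ^ 2) := by gcongr; linarith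
    _ ≤ constC d * (1 + ε) * √ε * (V * τ + W / 2 * τ ^ 2) := by
        gcongr
        exact le_mul_of_one_le_right hC (by linarith)

end FixedPerturbation

section SmallPerturbations

variable {d : ℕ} {ε τ₀ C₀ C₁ C₂ C₃ M : ℝ} {A S₀ : Matrix (Fin d) (Fin d) ℝ}
  {F : Vec d → Vec d} {m₀ : Vec d} {y xhat : ℝ → Vec d} {S : ℝ → Matrix (Fin d) (Fin d) ℝ}

lemma exists_forall_Icc_le_of_isBoundedUnder {f : ℝ → ℝ}
    (hf : IsBoundedUnder (· ≤ ·) (𝓝[>] 0) f) : ∃ δ > 0, ∃ b, ∀ τ ∈ Icc 0 δ, f τ ≤ b := by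
  obtain ⟨b, hb⟩ := hf.eventually_le
  obtain ⟨δ, hδ, hδb⟩ := mem_nhdsGT_iff_exists_Ioc_subset.1 hb
  refine ⟨δ, hδ, max b (f 0), fun τ hτ => ?_⟩
  rcases hτ.1.eq_or_lt with rfl | hτ_pos
  · exact le_max_right _ _
  · exact le_max_of_le_left (hδb ⟨hτ_pos, hτ.2⟩)

lemma exists_pos_one_sub_two_mul_rpow_le_exp (p : ℝ) :
    ∃ η > 0, η < 1 / 2 ∧ (1 - 2 * η) ^ p ≤ Real.exp 1 := by
  have hcont : ContinuousAt (fun η : ℝ => (1 - 2 * η) ^ p) 0 :=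
    ContinuousAt.rpow_const (by fun_prop) (Or.inl (by norm_num))
  have hlt : ∀ᶠ η : ℝ in 𝓝 0, (1 - 2 * η) ^ p < Real.exp 1 :=
    hcont.eventually_lt_const (by simp)
  obtain ⟨η, ⟨hη, hη_half⟩, hη_pos⟩ := (((hlt.and (eventually_lt_nhds one_half_pos)).filter_mono
    nhdsWithin_le_nhds).and self_mem_nhdsWithin : ∀ᶠ η in 𝓝[>] (0 : ℝ), _ ∧ η ∈ Ioi 0).exists
  exact ⟨η, hη_pos, hη_half, hη.le⟩

lemma exists_forall_norm_le_and_opNorm_mul_matSqrt_le (hε : 0 ≤ ε) (hF : ContDiff ℝ 3 F)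
    (hS₀ : S₀.PosDef) (hτ₀ : 0 < τ₀)
    (hpos : ∀ τ ∈ Icc 0 τ₀,
      (hessian (perturbedPotential ε A F m₀ S₀ τ (y τ) (xhat τ)) (xhat τ)).PosDef)
    (hS : ∀ τ ∈ Icc 0 τ₀,
      S τ = (hessian (perturbedPotential ε A F m₀ S₀ τ (y τ) (xhat τ)) (xhat τ))⁻¹)
    (hy : IsBoundedUnder (· ≤ ·) (𝓝[>] 0) fun τ => ‖y τ‖) (hM : 0 ≤ M)
    (hF₀ : ∀ τ ∈ Icc 0 τ₀, ∀ x, diffNorm (S τ) 0 F x ≤ C₀)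
    (hF₁ : ∀ τ ∈ Icc 0 τ₀, ∀ x, diffNorm (S τ) 1 F x ≤ C₁)
    (hF₂ : ∀ τ ∈ Icc 0 τ₀, ∀ x, diffNorm (S τ) 2 F x ≤ C₂)
    (hFM : ∀ x, M < ‖x‖ → iteratedFDeriv ℝ 3 F x = 0) :
    ∃ δ > 0, δ ≤ τ₀ ∧ ∃ b σ, ∀ τ ∈ Icc 0 δ, ‖y τ‖ ≤ b ∧ opNorm (A * matSqrt (S τ)) ≤ σ := by
  obtain ⟨δ, hδ, b, hb⟩ := exists_forall_Icc_le_of_isBoundedUnder hy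
  refine ⟨min δ τ₀, lt_min hδ hτ₀, min_le_right _ _, b,
    1 + τ₀ * (C₁ + C₂ * (opNorm A * M + b + τ₀ * C₀)), fun τ ⟨hτ, hτ_le⟩ => ?_⟩
  obtain ⟨hτδ, hττ₀⟩ := le_min_iff.1 hτ_le
  have hmem : τ ∈ Icc 0 τ₀ := ⟨hτ, hττ₀⟩
  have hyb := hb τ ⟨hτ, hτδ⟩
  have hA := opNorm_nonneg A
  have hC₀ := (diffNorm_nonneg (S τ) 0 F 0).trans (hF₀ τ hmem 0)
  have hC₁ := (diffNorm_nonneg (S τ) 1 F 0).trans (hF₁ τ hmem 0)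
  have hC₂ := (diffNorm_nonneg (S τ) 2 F 0).trans (hF₂ τ hmem 0)
  refine ⟨hyb, (opNorm_mul_matSqrt_inv_hessian_le hε A hF m₀ hS₀ hτ (y τ) (xhat τ) (hpos τ hmem)
    (hS τ hmem) hM (hF₀ τ hmem) (hF₁ τ hmem) (hF₂ τ hmem) hFM).trans ?_⟩
  gcongr

lemma exists_forall_constV_le_and_mul_constQ_le {η : ℝ} (hη : 0 < η) (hτ₀ : 0 < τ₀)
    (hC₀ : 0 ≤ C₀) (hC₁ : 0 ≤ C₁) (hC₂ : 0 ≤ C₂) (hC₃ : 0 ≤ C₃) {b σ : ℝ}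
    (hbound : ∀ τ ∈ Icc 0 τ₀, ‖y τ‖ ≤ b ∧ opNorm (A * matSqrt (S τ)) ≤ σ) :
    ∃ δ > 0, δ ≤ τ₀ ∧ ∃ Vmax, ∀ τ ∈ Icc 0 δ,
      constV C₂ C₃ M A (S τ) (y τ) ≤ Vmax ∧ τ * constQ C₀ C₁ C₂ M τ A (S τ) (y τ) ≤ η := by
  set Q := 2 * C₁ * (σ + τ₀ * C₁) + C₂ * (opNorm A * M + b + τ₀ * C₀) with hQ
  refine ⟨min τ₀ (η / (|Q| + 1)), by positivity, min_le_left _ _,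
    C₃ * (opNorm A * M + b) + 3 * C₂ * σ, fun τ ⟨hτ, hτ_le⟩ => ?_⟩
  obtain ⟨hττ₀, hτη⟩ := le_min_iff.1 hτ_le
  obtain ⟨hyb, hσ⟩ := hbound τ ⟨hτ, hττ₀⟩
  constructor
  · rw [constV]
    gcongr
  · calc τ * constQ C₀ C₁ C₂ M τ A (S τ) (y τ)
        ≤ τ * Q := by rw [constQ, hQ]; gcongr
      _ ≤ τ * (|Q| + 1) := by gcongr; linarith [le_abs_self Q]
      _ ≤ η := (le_div_iff₀ (by positivity)).1 hτη

lemma mul_add_half_mul_sq_le {K V Vmax W τ : ℝ} (hK : 0 ≤ K) (hW : 0 ≤ W) (hV : V ≤ Vmax)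
    (hτ : τ ∈ Icc 0 τ₀) : K * (V * τ + W / 2 * τ ^ 2) ≤ K * (Vmax + W / 2 * τ₀) * τ := by
  obtain ⟨hτ_nonneg, hτ_le⟩ := hτ
  rw [mul_assoc, add_mul, mul_assoc (W / 2), sq]
  gcongr

end SmallPerturbations

end LaplaceApprox

end

theorem theorem5p3_general (d : ℕ) (hd : 0 < d) (ε : ℝ) (hε : 0 < ε)
    (A : Matrix (Fin d) (Fin d) ℝ) (F : Vec d → Vec d) (hF : ContDiff ℝ 3 F)
    (m₀ : Vec d) (S₀ : Matrix (Fin d) (Fin d) ℝ) (hS₀ : S₀.PosDef)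
    (y xhat : ℝ → Vec d) (S : ℝ → Matrix (Fin d) (Fin d) ℝ)
    (τ₀ : ℝ) (hτ₀ : 0 < τ₀)
    (hcrit : ∀ τ ∈ Icc 0 τ₀,
      fderiv ℝ (perturbedPotential ε A F m₀ S₀ τ (y τ) (xhat τ)) (xhat τ) = 0)
    (hpos : ∀ τ ∈ Icc 0 τ₀,
      (hessian (perturbedPotential ε A F m₀ S₀ τ (y τ) (xhat τ)) (xhat τ)).PosDef)
    (hS : ∀ τ ∈ Icc 0 τ₀,
      S τ = (hessian (perturbedPotential ε A F m₀ S₀ τ (y τ) (xhat τ)) (xhat τ))⁻¹)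
    (hy : IsBoundedUnder (· ≤ ·) (𝓝[>] 0) fun τ => ‖y τ‖)
    (C₀ C₁ C₂ C₃ M : ℝ) (hM : 0 ≤ M)
    (hF₀ : ∀ τ ∈ Icc 0 τ₀, ∀ x, diffNorm (S τ) 0 F x ≤ C₀)
    (hF₁ : ∀ τ ∈ Icc 0 τ₀, ∀ x, diffNorm (S τ) 1 F x ≤ C₁)
    (hF₂ : ∀ τ ∈ Icc 0 τ₀, ∀ x, diffNorm (S τ) 2 F x ≤ C₂)
    (hF₃ : ∀ τ ∈ Icc 0 τ₀, ∀ x, diffNorm (S τ) 3 F x ≤ C₃)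
    (hFM : ∀ x, x ∉ Metric.closedBall (0 : Vec d) M → iteratedFDeriv ℝ 3 F x = 0) :
    ∃ τ₁ : ℝ, 0 < τ₁ ∧ τ₁ ≤ τ₀ ∧
      (∀ τ ∈ Icc 0 τ₁,
        tvDist (perturbedPosterior ε A F m₀ S₀ τ (y τ))
            (laplace ε (perturbedPotential ε A F m₀ S₀ τ (y τ) (xhat τ)) (xhat τ)) ≤
          constC d * (1 + ε) * √ε *
            (constV C₂ C₃ M A (S τ) (y τ) * τ + constW C₀ C₁ C₂ C₃ / 2 * τ ^ 2)) ∧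
      Bornology.IsBounded ((fun τ => constV C₂ C₃ M A (S τ) (y τ)) '' Icc 0 τ₁) ∧
      ∃ L : ℝ, ∀ τ ∈ Icc 0 τ₁,
        tvDist (perturbedPosterior ε A F m₀ S₀ τ (y τ))
            (laplace ε (perturbedPotential ε A F m₀ S₀ τ (y τ) (xhat τ)) (xhat τ)) ≤ L * τ := by
  have hFM' : ∀ x, M < ‖x‖ → iteratedFDeriv ℝ 3 F x = 0 := fun x hx =>
    hFM x (by rwa [mem_closedBall_zero_iff, not_le])
  have h0 : (0 : ℝ) ∈ Icc 0 τ₀ := left_mem_Icc.2 hτ₀.le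
  have hC₀ := (diffNorm_nonneg (S 0) 0 F 0).trans (hF₀ 0 h0 0)
  have hC₁ := (diffNorm_nonneg (S 0) 1 F 0).trans (hF₁ 0 h0 0)
  have hC₂ := (diffNorm_nonneg (S 0) 2 F 0).trans (hF₂ 0 h0 0)
  have hC₃ := (diffNorm_nonneg (S 0) 3 F 0).trans (hF₃ 0 h0 0)
  obtain ⟨η, hη, hη_lt, hη_rpow⟩ := exists_pos_one_sub_two_mul_rpow_le_exp (-((d : ℝ) + 3) / 2)
  obtain ⟨δ, hδ, hδτ₀, b, σ, hbound⟩ := exists_forall_norm_le_and_opNorm_mul_matSqrt_le hε.le hF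
    hS₀ hτ₀ hpos hS hy hM hF₀ hF₁ hF₂ hFM'
  obtain ⟨τ₁, hτ₁, hτ₁δ, Vmax, hV⟩ :=
    exists_forall_constV_le_and_mul_constQ_le (M := M) hη hδ hC₀ hC₁ hC₂ hC₃ hbound
  have hmem : ∀ τ ∈ Icc 0 τ₁, τ ∈ Icc 0 τ₀ := Icc_subset_Icc_right (hτ₁δ.trans hδτ₀)
  have hTV := fun τ (hτ : τ ∈ Icc 0 τ₁) =>
    tvDist_perturbedPosterior_laplace_le hd hε hF hS₀ hτ.1 (hcrit τ (hmem τ hτ))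
      (hpos τ (hmem τ hτ)) (hS τ (hmem τ hτ)) hM (hF₀ τ (hmem τ hτ)) (hF₁ τ (hmem τ hτ))
      (hF₂ τ (hmem τ hτ)) (hF₃ τ (hmem τ hτ)) hFM' (hV τ hτ).2 hη_lt hη_rpow
  refine ⟨τ₁, hτ₁, hτ₁δ.trans hδτ₀, hTV, (Metric.isBounded_Icc 0 Vmax).subset ?_, _, fun τ hτ =>
    (hTV τ hτ).trans (mul_add_half_mul_sq_le ?_ (constW_nonneg hC₀ hC₁ hC₂ hC₃) (hV τ hτ).1
      (hmem τ hτ))⟩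
  · exact image_subset_iff.2 fun τ hτ => ⟨constV_nonneg hC₂ hC₃ hM A (S τ) (y τ), (hV τ hτ).1⟩
  · have := constC_nonneg d
    positivity

theorem theorem5p3 (d : ℕ) (hd : 0 < d) (ε : ℝ) (hε : 0 < ε)
    (A : Matrix (Fin d) (Fin d) ℝ) (F : Vec d → Vec d) (hF : ContDiff ℝ 3 F)
    (m₀ : Vec d) (S₀ : Matrix (Fin d) (Fin d) ℝ) (hS₀ : S₀.PosDef)
    -- data, MAP estimates and covariances, indexed by `τ`
    (y xhat : ℝ → Vec d) (S : ℝ → Matrix (Fin d) (Fin d) ℝ)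
    (τ₀ : ℝ) (hτ₀ : 0 < τ₀)
    (hmin : ∀ τ ∈ Icc 0 τ₀,
      IsUniqueMinimizer (perturbedPotential ε A F m₀ S₀ τ (y τ) (xhat τ)) (xhat τ))
    (hpos : ∀ τ ∈ Icc 0 τ₀,
      (hessian (perturbedPotential ε A F m₀ S₀ τ (y τ) (xhat τ)) (xhat τ)).PosDef)
    (hS : ∀ τ ∈ Icc 0 τ₀,
      S τ = (hessian (perturbedPotential ε A F m₀ S₀ τ (y τ) (xhat τ)) (xhat τ))⁻¹)
    (ylim xlim : Vec d) (Slim : Matrix (Fin d) (Fin d) ℝ)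
    (hylim : Tendsto y (𝓝[>] 0) (𝓝 ylim))
    (hxlim : Tendsto xhat (𝓝[>] 0) (𝓝 xlim))
    (hSlim : Tendsto S (𝓝[>] 0) (𝓝 Slim)) (hSlimpos : Slim.PosDef)
    (C₀ C₁ C₂ C₃ M : ℝ) (hC₀ : 0 < C₀) (hC₁ : 0 < C₁) (hC₂ : 0 < C₂) (hC₃ : 0 < C₃) (hM : 0 < M)
    (hF₀ : ∀ τ ∈ Icc 0 τ₀, ∀ x, diffNorm (S τ) 0 F x ≤ C₀)
    (hF₁ : ∀ τ ∈ Icc 0 τ₀, ∀ x, diffNorm (S τ) 1 F x ≤ C₁)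
    (hF₂ : ∀ τ ∈ Icc 0 τ₀, ∀ x, diffNorm (S τ) 2 F x ≤ C₂)
    (hF₃ : ∀ τ ∈ Icc 0 τ₀, ∀ x, diffNorm (S τ) 3 F x ≤ C₃)
    (hFM : ∀ x, x ∉ Metric.closedBall (0 : Vec d) M → iteratedFDeriv ℝ 3 F x = 0) :
    ∃ τ₁ : ℝ, 0 < τ₁ ∧ τ₁ ≤ τ₀ ∧
      (∀ τ ∈ Icc 0 τ₁,
        tvDist (perturbedPosterior ε A F m₀ S₀ τ (y τ))
            (laplace ε (perturbedPotential ε A F m₀ S₀ τ (y τ) (xhat τ)) (xhat τ)) ≤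
          constC d * (1 + ε) * √ε *
            (constV C₂ C₃ M A (S τ) (y τ) * τ + constW C₀ C₁ C₂ C₃ / 2 * τ ^ 2)) ∧
      Bornology.IsBounded ((fun τ => constV C₂ C₃ M A (S τ) (y τ)) '' Icc 0 τ₁) ∧
      ∃ L : ℝ, ∀ τ ∈ Icc 0 τ₁,
        tvDist (perturbedPosterior ε A F m₀ S₀ τ (y τ))
            (laplace ε (perturbedPotential ε A F m₀ S₀ τ (y τ) (xhat τ)) (xhat τ)) ≤ L * τ :=
  theorem5p3_general d hd ε hε A F hF m₀ S₀ hS₀ y xhat S τ₀ hτ₀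
    (fun τ hτ => (hmin τ hτ).fderiv_eq_zero) hpos hS hylim.norm.isBoundedUnder_le C₀ C₁ C₂ C₃
    M hM.le hF₀ hF₁ hF₂ hF₃ hFM
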